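/- Let $\mathcal U,\mathcal Y$ be complex Hilbert spaces, $\mathbb C^+=\{\mu\in\mathbb C:\operatorname{Re}\mu>0\}$, $\mathbb D=\{z\in\mathbb C:|z|<1\}$, let $\varphi:\mathbb C^+\to\mathcal B(\mathcal U,\mathcal Y)$ be holomorphic with contractive values, $\widetilde\varphi(\mu)=\varphi(\overline\mu)^*$, and let $\mathcal H_c$ be the Hilbert space of $\mathcal U$-valued functions on $\mathbb C^+$ with reproducing kernel $$K_c(\mu,\lambda)=\frac{1-\varphi(\overline\mu)^*\varphi(\overline\lambda)}{\mu+\overline\lambda}.$$ Let $e_c(\lambda)$ be point evaluation at $\lambda$ on $\mathcal H_c$, so that $e_c(\lambda)^*u=K_c(\cdot,\lambda)u$. Let $\left[\begin{smallmatrix}A\&B\\C\&D\end{smallmatrix}\right]_c$, from a subspace of $\mathcal H_c\oplus\mathcal U$ into $\mathcal H_c\oplus\mathcal Y$, be the canonical controllable energy-preserving model of $\varphi$, i.e. the closure of the linear operator determined by $$\begin{bmatrix}e_c(\overline\lambda)^*u\\u\end{bmatrix}\mapsto\begin{bmatrix}\lambda e_c(\overline\lambda)^*u\\\varphi(\lambda)u\end{bmatrix},\qquad\lambda\in\mathbb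 C^+,\ u\in\mathcal U.$$ Denote its main, control and observation operators by $A_c,B_c,C_c$ and its transfer function by $\widehat{\mathfrak D}$. Fix $\alpha\in\mathbb C^+$. Then the model is a system node, $\alpha$ lies in the resolvent set of $A_c$, and, with $\tau_{c,\alpha}:=C_c(\alpha-A_c)^{-1}$, the following hold. 1. The Cayley transform with parameter $\alpha$ of $\left[\begin{smallmatrix}A\&B\\C\&D\end{smallmatrix}\right]_c$, that is, the bounded operator $\left[\begin{smallmatrix}\mathbf A_c&\mathbf B_c\\\mathbf C_c&\mathbf D_c\end{smallmatrix}\right]$ with $$\mathbf A_c=(\overline\alpha+A_c)(\alpha-A_c)^{-1},\quad \mathbf B_c=\sqrt{2\operatorname{Re}\alpha}\,(\alpha-A_c|_{\mathcal H_c})^{-1}B_c,\quad \mathbf C_c=\sqrt{2\operatorname{Re}\alpha}\,C_c(\alpha-A_c)^{-1},\quad \mathbf D_c=\widehat{\mathfrak D}(\alpha),$$ is an isometry from $\mathcal H_c\oplus\mathcal U$ into $\mathcal H_c\oplus\mathcal Y$, and it is given by $$(\mathbf A_cx)(\mu)=\frac{\overline\alpha-\mu}{\alpha+\mu}\,x(\mu)-\frac{2\operatorname{Re}\alpha}{\alpha+\mu}\,\widetilde\varphi(\mu)\,\tau_{c,\alpha}x,\qquad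 \mathbf B_cu=\sqrt{2\operatorname{Re}\alpha}\,e_c(\overline\alpha)^*u,$$ $$\mathbf C_cx=\sqrt{2\operatorname{Re}\alpha}\,\tau_{c,\alpha}x,\qquad \mathbf D_cu=\varphi(\alpha)u,\qquad x\in\mathcal H_c,\ u\in\mathcal U,\ \mu\in\mathbb C^+.$$ 2. Let $\phi_\alpha(z)=\varphi\big(\tfrac{\alpha-\overline\alpha z}{1+z}\big)$ for $z\in\mathbb D$, and let $\mathrm H_{c,\alpha}$ be the Hilbert space of functions on $\mathbb D$ with reproducing kernel $\frac{1-\phi_\alpha(\overline z)^*\phi_\alpha(\overline w)}{1-z\overline w}$. Then $$(\Xi_{\overline\alpha}\xi)(\mu)=\frac{\sqrt{2\operatorname{Re}\alpha}}{\alpha+\mu}\,\xi\Big(\frac{\overline\alpha-\mu}{\alpha+\mu}\Big),\qquad\mu\in\mathbb C^+,$$ defines a unitary operator $\Xi_{\overline\alpha}$ from $\mathrm H_{c,\alpha}$ onto $\mathcal H_c$. 3. Let $\mathrm A_c,\mathrm B_c,\mathrm C_c,\mathrm D_c$ be the bounded operators of the controllable isometric de Branges–Rovnyak model of $\phi_\alpha$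 on $\mathrm H_{c,\alpha}$: $$(\mathrm A_cg)(z)=z\,g(z)-\phi_\alpha(\overline z)^*\mathrm C_cg,\qquad(\mathrm B_cu)(z)=\big(1-\phi_\alpha(\overline z)^*\phi_\alpha(0)\big)u,\qquad\mathrm D_cu=\phi_\alpha(0)u,$$ where $\mathrm C_cg\in\mathcal Y$ is the unique vector with $\langle\mathrm C_cg,y\rangle_{\mathcal Y}=\big\langle g,\ z\mapsto\tfrac{\phi_\alpha(\overline z)^*-\phi_\alpha(0)^*}{z}y\big\rangle_{\mathrm H_{c,\alpha}}$ for all $y\in\mathcal Y$ (the singularity at $z=0$ being removable). Then $$\begin{bmatrix}\mathbf A_c\Xi_{\overline\alpha}&\mathbf B_c\\\mathbf C_c\Xi_{\overline\alpha}&\mathbf D_c\end{bmatrix}=\begin{bmatrix}\Xi_{\overline\alpha}\mathrm A_c&\Xi_{\overline\alpha}\mathrm B_c\\\mathrm C_c&\mathrm D_c\end{bmatrix}.$$ -/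

import Mathlib

noncomputable section

open Complex Metric Filter Topology
open scoped ComplexConjugate InnerProductSpace NNReal

namespace DeBrangesRovnyak

/-! ### Positivity of the de Branges-Rovnyak kernels -/

section Positivity

variable {V W : Type*} [NormedAddCommGroup V] [InnerProductSpace ℂ V]
  [NormedAddCommGroup W] [InnerProductSpace ℂ W]

theorem circleAverage_inner_sum_szego {ι : Type*} (s : Finset ι) {R : ℝ} (hR : 0 < R)
    (z : ι → ℂ) (hz : ∀ i ∈ s, ‖z i‖ < R) (g : ι → V) {h : ℂ → V}
    (hh : DiffContOnCl ℂ h (ball 0 R)) :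
    Real.circleAverage (fun ζ => ⟪∑ i ∈ s, (1 - ζ * conj (z i) / R ^ 2)⁻¹ • g i, h ζ⟫_ℂ) 0 R
      = ∑ i ∈ s, ⟪g i, h (z i)⟫_ℂ := by
  have hcl : closure (ball (0 : ℂ) R) = closedBall 0 R := closure_ball _ hR.ne'
  have hcont : ContinuousOn h (sphere 0 R) :=
    hh.continuousOn.mono (by rw [hcl]; exact sphere_subset_closedBall)
  have hne : ∀ i ∈ s, ∀ ζ ∈ sphere (0 : ℂ) R, ζ - z i ≠ 0 := by
    intro i hi ζ hζ h0
    have := hz i hi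
    rw [← sub_eq_zero.mp h0, mem_sphere_zero_iff_norm.mp hζ] at this
    exact lt_irrefl _ this
  have h1 : Set.EqOn (fun ζ => ⟪∑ i ∈ s, (1 - ζ * conj (z i) / R ^ 2)⁻¹ • g i, h ζ⟫_ℂ)
      (fun ζ => ∑ i ∈ s, ((ζ - 0) / (ζ - z i)) • ⟪g i, h ζ⟫_ℂ) (sphere 0 |R|) := by
    rw [abs_of_pos hR]
    intro ζ hζ
    simp only [sum_inner, inner_smul_left, smul_eq_mul, sub_zero]
    refine Finset.sum_congr rfl fun i hi => ?_
    congr 1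
    have hn := mem_sphere_zero_iff_norm.mp hζ
    have hζ0 : ζ ≠ 0 := by rintro rfl; simp at hn; exact hR.ne hn
    have hc : conj ζ = R ^ 2 / ζ := by
      rw [eq_div_iff hζ0, mul_comm, Complex.mul_conj, Complex.normSq_eq_norm_sq, hn]; simp
    have hR' : (R : ℂ) ≠ 0 := by exact_mod_cast hR.ne'
    have := hne i hi ζ hζ
    simp only [map_inv₀, map_sub, map_one, map_div₀, map_mul, conj_conj, map_pow, conj_ofReal, hc]
    rw [show (1 : ℂ) - R ^ 2 / ζ * z i / R ^ 2 = (ζ - z i) / ζ by field_simp]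
    rw [inv_div]
  rw [Real.circleAverage_congr_sphere h1, Real.circleAverage_fun_sum]
  · refine Finset.sum_congr rfl fun i hi => ?_
    refine DiffContOnCl.circleAverage_smul_div (f := fun ζ => ⟪g i, h ζ⟫_ℂ) ?_ ?_
    · rw [abs_of_pos hR]
      exact (innerSL ℂ (g i)).differentiable.comp_diffContOnCl hh
    · rw [abs_of_pos hR]; simpa using hz i hi
  · intro i hi
    refine ContinuousOn.circleIntegrable hR.le ?_
    have c1 : ContinuousOn (fun ζ => ⟪g i, h ζ⟫_ℂ) (sphere 0 R) :=
      ContinuousOn.inner (𝕜 := ℂ) continuousOn_const hcont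
    have c2 : ContinuousOn (fun ζ : ℂ => (ζ - 0) / (ζ - z i)) (sphere 0 R) :=
      ContinuousOn.div (by fun_prop) (by fun_prop) (hne i hi)
    exact c2.smul c1

variable [CompleteSpace V] [CompleteSpace W]

theorem schur_kernel_sum_nonneg_aux {ψ : ℂ → W →L[ℂ] V} (hd : DifferentiableOn ℂ ψ (ball 0 1))
    (hn : ∀ z ∈ ball (0 : ℂ) 1, ‖ψ z‖ ≤ 1) {ι : Type*} (s : Finset ι) (z : ι → ℂ) (g : ι → V)
    {R : ℝ} (hR : 0 < R) (hR1 : R < 1) (hz : ∀ i ∈ s, ‖z i‖ < R) :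
    0 ≤ (∑ i ∈ s, ∑ j ∈ s, (1 - z i * conj (z j) / R ^ 2)⁻¹ *
      ⟪g i, g j - ψ (z i) ((ψ (z j)).adjoint (g j))⟫_ℂ).re := by
  set f : ℂ → V := fun ζ => ∑ i ∈ s, (1 - ζ * conj (z i) / R ^ 2)⁻¹ • g i with hf
  set p : ℂ → W := fun ζ => ∑ i ∈ s, (1 - ζ * conj (z i) / R ^ 2)⁻¹ • (ψ (z i)).adjoint (g i)
    with hp
  have hcl : closure (ball (0 : ℂ) R) = closedBall 0 R := closure_ball _ hR.ne'
  have hsub : closedBall (0 : ℂ) R ⊆ ball 0 1 := closedBall_subset_ball hR1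
  have hne : ∀ i ∈ s, ∀ ζ ∈ closedBall (0 : ℂ) R, 1 - ζ * conj (z i) / (R : ℂ) ^ 2 ≠ 0 := by
    intro i hi ζ hζ h0
    have hζ' : ‖ζ‖ ≤ R := by simpa using hζ
    have h1 : ‖ζ * conj (z i) / (R : ℂ) ^ 2‖ = 1 := by rw [← sub_eq_zero.mp h0]; simp
    rw [norm_div, norm_mul, RCLike.norm_conj, norm_pow, Complex.norm_real, Real.norm_of_nonneg hR.le,
      div_eq_one_iff_eq (by positivity)] at h1
    nlinarith [hz i hi, norm_nonneg (z i), norm_nonneg ζ]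
  have hdk : ∀ i ∈ s, ∀ ζ ∈ closedBall (0 : ℂ) R,
      DifferentiableAt ℂ (fun ζ => (1 - ζ * conj (z i) / (R : ℂ) ^ 2)⁻¹) ζ := by
    intro i hi ζ hζ
    exact DifferentiableAt.inv (by fun_prop) (hne i hi ζ hζ)
  have hdf : DifferentiableOn ℂ f (closedBall 0 R) := by
    intro ζ hζ
    refine DifferentiableAt.differentiableWithinAt ?_
    exact DifferentiableAt.fun_sum fun i hi => (hdk i hi ζ hζ).smul_const _
  have hdp : DifferentiableOn ℂ p (closedBall 0 R) := by
    intro ζ hζ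
    refine DifferentiableAt.differentiableWithinAt ?_
    exact DifferentiableAt.fun_sum fun i hi => (hdk i hi ζ hζ).smul_const _
  have hdq : DifferentiableOn ℂ (fun ζ => ψ ζ (p ζ)) (closedBall 0 R) :=
    (hd.mono hsub).clm_apply hdp
  have e1 := circleAverage_inner_sum_szego s hR z hz g ⟨hdf.mono ball_subset_closedBall, by rw [hcl]; exact hdf.continuousOn⟩
  have e2 := circleAverage_inner_sum_szego s hR z hz g ⟨hdq.mono ball_subset_closedBall, by rw [hcl]; exact hdq.continuousOn⟩
  have e3 := circleAverage_inner_sum_szego s hR z hz (fun i => (ψ (z i)).adjoint (g i)) ⟨hdp.mono ball_subset_closedBall, by rw [hcl]; exact hdp.continuousOn⟩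
  have hss : sphere (0 : ℂ) R ⊆ closedBall 0 R := sphere_subset_closedBall
  have cf := hdf.continuousOn.mono hss
  have cp := hdp.continuousOn.mono hss
  have cq := hdq.continuousOn.mono hss
  have i1 : CircleIntegrable (fun ζ => ⟪f ζ, f ζ⟫_ℂ) 0 R :=
    (ContinuousOn.inner (𝕜 := ℂ) cf cf).circleIntegrable hR.le
  have i2 : CircleIntegrable (fun ζ => ⟪f ζ, ψ ζ (p ζ)⟫_ℂ) 0 R :=
    (ContinuousOn.inner (𝕜 := ℂ) cf cq).circleIntegrable hR.le
  have i3 : CircleIntegrable (fun ζ => ⟪p ζ, p ζ⟫_ℂ) 0 R :=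
    (ContinuousOn.inner (𝕜 := ℂ) cp cp).circleIntegrable hR.le
  have i22 : CircleIntegrable (fun ζ => ⟪f ζ, ψ ζ (p ζ)⟫_ℂ + ⟪f ζ, ψ ζ (p ζ)⟫_ℂ) 0 R := i2.add i2
  have i12 : CircleIntegrable
      (fun ζ => ⟪f ζ, f ζ⟫_ℂ - (⟪f ζ, ψ ζ (p ζ)⟫_ℂ + ⟪f ζ, ψ ζ (p ζ)⟫_ℂ)) 0 R := i1.sub i22
  have hcomm := Complex.reCLM.circleAverage_comp_comm (f := fun ζ =>
    (⟪f ζ, f ζ⟫_ℂ - (⟪f ζ, ψ ζ (p ζ)⟫_ℂ + ⟪f ζ, ψ ζ (p ζ)⟫_ℂ)) + ⟪p ζ, p ζ⟫_ℂ) (c := 0) (R := R)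
    (i12.add i3)
  have hnn : 0 ≤ Real.circleAverage (Complex.reCLM ∘ fun ζ =>
    (⟪f ζ, f ζ⟫_ℂ - (⟪f ζ, ψ ζ (p ζ)⟫_ℂ + ⟪f ζ, ψ ζ (p ζ)⟫_ℂ)) + ⟪p ζ, p ζ⟫_ℂ) 0 R := by
    refine Real.circleAverage_nonneg_of_nonneg fun ζ hζ => ?_
    rw [abs_of_pos hR] at hζ
    have hψ := hn ζ (hsub (hss hζ))
    have h1 : ‖ψ ζ (p ζ)‖ ≤ ‖p ζ‖ := by
      simpa using (ψ ζ).le_of_opNorm_le hψ (p ζ)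
    have h2 := norm_sub_sq (𝕜 := ℂ) (f ζ) (ψ ζ (p ζ))
    have h3 : (⟪f ζ, f ζ⟫_ℂ).re = ‖f ζ‖ ^ 2 := by
      rw [inner_self_eq_norm_sq_to_K]; norm_cast
    have h4 : (⟪p ζ, p ζ⟫_ℂ).re = ‖p ζ‖ ^ 2 := by
      rw [inner_self_eq_norm_sq_to_K]; norm_cast
    simp only [Function.comp, Complex.reCLM_apply, Complex.add_re, Complex.sub_re, h3, h4]
    have h5 : RCLike.re ⟪f ζ, ψ ζ (p ζ)⟫_ℂ = (⟪f ζ, ψ ζ (p ζ)⟫_ℂ).re := rfl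
    rw [h5] at h2
    nlinarith [sq_nonneg ‖f ζ - ψ ζ (p ζ)‖, norm_nonneg (ψ ζ (p ζ)), norm_nonneg (p ζ)]
  rw [hcomm, Real.circleAverage_fun_add i12 i3,
    Real.circleAverage_fun_sub i1 i22, Real.circleAverage_fun_add i2 i2, e1, e2, e3] at hnn
  refine le_of_le_of_eq hnn ?_
  rw [Complex.reCLM_apply]
  congr 1
  simp only [ContinuousLinearMap.adjoint_inner_left]
  rw [← Finset.sum_add_distrib, ← Finset.sum_sub_distrib, ← Finset.sum_add_distrib]
  refine Finset.sum_congr rfl fun i _ => ?_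
  simp only [hf, hp, inner_sum, map_sum, map_smul, inner_smul_right, inner_sub_right, mul_sub,
    Finset.sum_sub_distrib]
  ring

theorem schur_kernel_sum_nonneg {ψ : ℂ → W →L[ℂ] V} (hd : DifferentiableOn ℂ ψ (ball 0 1))
    (hn : ∀ z ∈ ball (0 : ℂ) 1, ‖ψ z‖ ≤ 1) {ι : Type*} (s : Finset ι) (z : ι → ℂ) (g : ι → V)
    (hz : ∀ i ∈ s, ‖z i‖ < 1) :
    0 ≤ (∑ i ∈ s, ∑ j ∈ s, (1 - z i * conj (z j))⁻¹ *
      ⟪g i, g j - ψ (z i) ((ψ (z j)).adjoint (g j))⟫_ℂ).re := by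
  have hlim : Tendsto (fun R : ℝ => (∑ i ∈ s, ∑ j ∈ s, (1 - z i * conj (z j) / (R : ℂ) ^ 2)⁻¹ *
      ⟪g i, g j - ψ (z i) ((ψ (z j)).adjoint (g j))⟫_ℂ).re) (𝓝[<] 1)
      (𝓝 (∑ i ∈ s, ∑ j ∈ s, (1 - z i * conj (z j))⁻¹ *
      ⟪g i, g j - ψ (z i) ((ψ (z j)).adjoint (g j))⟫_ℂ).re) := by
    refine tendsto_nhdsWithin_of_tendsto_nhds ?_
    refine (Complex.continuous_re.tendsto _).comp ?_
    refine tendsto_finsetSum _ fun i hi => tendsto_finsetSum _ fun j hj => ?_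
    refine Tendsto.mul_const _ ?_
    have hne : (1 : ℂ) - z i * conj (z j) ≠ 0 := by
      intro h0
      have h1 : ‖z i * conj (z j)‖ = 1 := by rw [← sub_eq_zero.mp h0]; simp
      rw [norm_mul, RCLike.norm_conj] at h1
      nlinarith [hz i hi, hz j hj, norm_nonneg (z i), norm_nonneg (z j)]
    refine Tendsto.inv₀ ?_ hne
    have : ContinuousAt (fun R : ℝ => (1 : ℂ) - z i * conj (z j) / (R : ℂ) ^ 2) 1 := by
      refine ContinuousAt.sub continuousAt_const (ContinuousAt.div continuousAt_const ?_ (by simp))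
      fun_prop
    simpa using this.tendsto
  refine ge_of_tendsto hlim ?_
  have hev : ∀ i ∈ s, ∀ᶠ R : ℝ in 𝓝[<] 1, ‖z i‖ < R := fun i hi =>
    mem_nhdsWithin_of_mem_nhds (lt_mem_nhds (hz i hi))
  have h0 : ∀ᶠ R : ℝ in 𝓝[<] 1, 0 < R := mem_nhdsWithin_of_mem_nhds (lt_mem_nhds one_pos)
  filter_upwards [(Finset.eventually_all s).2 hev, h0, self_mem_nhdsWithin] with R h1 h2 h3
  exact schur_kernel_sum_nonneg_aux hd hn s z g h2 h3 h1

theorem differentiableOn_adjoint_conj {φ : ℂ → V →L[ℂ] W} {s t : Set ℂ} (ht : IsOpen t)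
    (hst : ∀ z ∈ s, conj z ∈ t) (h : DifferentiableOn ℂ φ t) :
    DifferentiableOn ℂ (fun z => (φ (conj z)).adjoint) s := by
  intro z hz
  have h1 := (h.differentiableAt (ht.mem_nhds (hst z hz))).hasDerivAt
  refine (HasDerivAt.differentiableAt (f' := (deriv φ (conj z)).adjoint) ?_).differentiableWithinAt
  rw [hasDerivAt_iff_tendsto_slope] at h1 ⊢
  have h2 : Tendsto (fun w : ℂ => conj w) (𝓝[≠] z) (𝓝[≠] (conj z)) := by
    refine tendsto_nhdsWithin_iff.2 ⟨?_, ?_⟩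
    · exact tendsto_nhdsWithin_of_tendsto_nhds (Complex.continuous_conj.tendsto z)
    · filter_upwards [self_mem_nhdsWithin] with w hw
      exact fun h => hw (by simpa using congrArg (starRingEnd ℂ) h)
  refine (((ContinuousLinearMap.adjoint (𝕜 := ℂ) (E := V) (F := W)).continuous.tendsto _).comp
    (h1.comp h2)).congr fun w => ?_
  simp [slope_def_module, map_smulₛₗ, Function.comp]
end Positivity

/-! ### Schur classes, kernels and reproducing kernel Hilbert spaces -/

section Spaces

/-- The open right half-plane. -/
abbrev RightHalfPlane : Type := {μ : ℂ // 0 < μ.re}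

/-- The open unit disk. -/
abbrev Disk : Type := {z : ℂ // ‖z‖ < 1}

/-- Complex conjugation on the right half-plane. -/
def RightHalfPlane.conj (μ : RightHalfPlane) : RightHalfPlane :=
  ⟨starRingEnd ℂ (μ : ℂ), by simpa using μ.2⟩

/-- The map `z_α(μ) = (α - μ) / (conj α + μ)` from the right half-plane to the unit disk. -/
def cayleyToDisk (α μ : RightHalfPlane) : Disk :=
  ⟨((α : ℂ) - μ) / (conj (α : ℂ) + μ), by
    have hα := α.2
    have hμ := μ.2
    have hne : conj (α : ℂ) + μ ≠ 0 := by
      intro h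
      have := congrArg Complex.re h
      simp at this
      linarith
    rw [norm_div, div_lt_one (norm_pos_iff.2 hne)]
    refine lt_of_pow_lt_pow_left₀ 2 (norm_nonneg _) ?_
    rw [← Complex.normSq_eq_norm_sq, ← Complex.normSq_eq_norm_sq, Complex.normSq_apply,
      Complex.normSq_apply]
    simp
    nlinarith [mul_pos hα hμ]⟩

/-- The inverse map `μ_α(z) = (α - conj α z) / (1 + z)`, as a formula on the complex plane. -/
def cayleyToHalfPlane (α : RightHalfPlane) (z : ℂ) : ℂ :=
  ((α : ℂ) - conj (α : ℂ) * z) / (1 + z)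

theorem one_add_ne_zero_of_norm_lt {z : ℂ} (hz : ‖z‖ < 1) : 1 + z ≠ 0 := by
  intro h
  have : ‖z‖ = 1 := by rw [← neg_eq_of_add_eq_zero_right h]; simp
  linarith

theorem cayleyToHalfPlane_re_pos (α : RightHalfPlane) {z : ℂ} (hz : ‖z‖ < 1) :
    0 < (cayleyToHalfPlane α z).re := by
  have hα := α.2
  have hne := one_add_ne_zero_of_norm_lt hz
  have hz2 : z.re * z.re + z.im * z.im < 1 := by
    have h1 : ‖z‖ ^ 2 < 1 := by nlinarith [norm_nonneg z]
    rwa [← Complex.normSq_eq_norm_sq, Complex.normSq_apply] at h1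
  have hpos : 0 < Complex.normSq (1 + z) := Complex.normSq_pos.2 hne
  rw [cayleyToHalfPlane, Complex.div_re, ← add_div]
  refine div_pos ?_ hpos
  simp
  nlinarith

variable (U Y : Type*) [NormedAddCommGroup U] [InnerProductSpace ℂ U]
  [NormedAddCommGroup Y] [InnerProductSpace ℂ Y]

/-- The Schur class of the right half-plane: holomorphic functions whose values are contractions
from `U` to `Y`.  Only the values on the right half-plane are ever used. -/
structure SchurHalfPlane where
  /-- the underlying function -/
  toFun : ℂ → U →L[ℂ] Y
  differentiableOn : DifferentiableOn ℂ toFun {μ | 0 < μ.re}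
  norm_le_one : ∀ μ : ℂ, 0 < μ.re → ‖toFun μ‖ ≤ 1

/-- The Schur class of the unit disk.  Only the values on the unit disk are ever used. -/
structure SchurDisk where
  /-- the underlying function -/
  toFun : ℂ → U →L[ℂ] Y
  differentiableOn : DifferentiableOn ℂ toFun {z | ‖z‖ < 1}
  norm_le_one : ∀ z : ℂ, ‖z‖ < 1 → ‖toFun z‖ ≤ 1

variable {U Y}

instance : CoeFun (SchurHalfPlane U Y) (fun _ => ℂ → U →L[ℂ] Y) := ⟨SchurHalfPlane.toFun⟩

instance : CoeFun (SchurDisk U Y) (fun _ => ℂ → U →L[ℂ] Y) := ⟨SchurDisk.toFun⟩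

/-- The function `φ_α(z) = φ(μ_α(z))` in the Schur class of the disk. -/
def SchurHalfPlane.toDisk (φ : SchurHalfPlane U Y) (α : RightHalfPlane) : SchurDisk U Y where
  toFun z := φ (cayleyToHalfPlane α z)
  differentiableOn := by
    refine φ.differentiableOn.comp (f := cayleyToHalfPlane α) ?_
      (fun z hz => cayleyToHalfPlane_re_pos α hz)
    intro z hz
    refine DifferentiableAt.differentiableWithinAt ?_
    exact DifferentiableAt.div (by fun_prop) (by fun_prop) (one_add_ne_zero_of_norm_lt hz)
  norm_le_one z hz := φ.norm_le_one _ (cayleyToHalfPlane_re_pos α hz)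

variable [CompleteSpace U] [CompleteSpace Y]

/-- The kernel `K_c(μ, λ) = (1 - φ(conj μ)^* φ(conj λ)) / (μ + conj λ)` on the right half-plane. -/
def kernelHalfPlane (φ : SchurHalfPlane U Y) : Matrix RightHalfPlane RightHalfPlane (U →L[ℂ] U) :=
  Matrix.of fun μ l => ((μ : ℂ) + conj (l : ℂ))⁻¹ •
    (1 - (φ (conj (μ : ℂ))).adjoint ∘L φ (conj (l : ℂ)))

/-- The kernel `K_c(z, w) = (1 - ψ(conj z)^* ψ(conj w)) / (1 - z conj w)` on the unit disk. -/
def kernelDisk (ψ : SchurDisk U Y) : Matrix Disk Disk (U →L[ℂ] U) :=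
  Matrix.of fun z w => (1 - (z : ℂ) * conj (w : ℂ))⁻¹ •
    (1 - (ψ (conj (z : ℂ))).adjoint ∘L ψ (conj (w : ℂ)))

theorem kernelDisk_sum_nonneg (ψ : SchurDisk U Y) {ι : Type*} (s : Finset ι) (z : ι → Disk)
    (g : ι → U) : 0 ≤ (∑ i ∈ s, ∑ j ∈ s, ⟪g i, kernelDisk ψ (z i) (z j) (g j)⟫_ℂ).re := by
  have hb : {z : ℂ | ‖z‖ < 1} = ball 0 1 := by ext; simp
  have hd : DifferentiableOn ℂ (fun z => (ψ (conj z)).adjoint) (ball 0 1) :=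
    differentiableOn_adjoint_conj (t := ball 0 1) isOpen_ball (fun z hz => by simpa using hz)
      (hb ▸ ψ.differentiableOn)
  have hn : ∀ z ∈ ball (0 : ℂ) 1, ‖(ψ (conj z)).adjoint‖ ≤ 1 := fun z hz => by
    rw [LinearIsometryEquiv.norm_map]
    exact ψ.norm_le_one _ (by simpa using hz)
  refine le_of_le_of_eq (schur_kernel_sum_nonneg hd hn s (fun i => (z i : ℂ)) g
    (fun i _ => (z i).2)) ?_
  congr 1
  refine Finset.sum_congr rfl fun i _ => Finset.sum_congr rfl fun j _ => ?_
  simp [kernelDisk]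

theorem kernelDisk_posSemidef (ψ : SchurDisk U Y) : (kernelDisk ψ).PosSemidef := by
  have htfae := (RKHS.posSemidef_tfae (K := kernelDisk ψ)).out 0 2
  refine htfae.2 ⟨?_, fun v => ?_⟩
  · ext z w : 1
    simp only [Matrix.conjTranspose_apply, kernelDisk, Matrix.of_apply, star_smul, star_sub,
      star_one, ContinuousLinearMap.star_eq_adjoint, ContinuousLinearMap.adjoint_comp,
      ContinuousLinearMap.adjoint_adjoint]
    simp [mul_comm]
  · have := kernelDisk_sum_nonneg ψ v.support id v
    rw [Finset.sum_comm] at this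
    rw [← RCLike.conj_re, Finsupp.sum]
    simpa [Finsupp.sum, map_sum] using this

theorem kernelHalfPlane_eq (φ : SchurHalfPlane U Y) (μ l : RightHalfPlane) :
    kernelHalfPlane φ μ l = (2 * ((1 + (μ : ℂ))⁻¹ * conj (1 + (l : ℂ))⁻¹)) •
      kernelDisk (φ.toDisk ⟨1, by simp⟩) (cayleyToDisk ⟨1, by simp⟩ μ)
        (cayleyToDisk ⟨1, by simp⟩ l) := by
  have h1 : ∀ μ : RightHalfPlane, 1 + (μ : ℂ) ≠ 0 := fun μ h => by
    have := congrArg Complex.re h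
    have := μ.2
    simp at *
    linarith
  have h2 : ∀ μ : RightHalfPlane, cayleyToHalfPlane ⟨1, by simp⟩
      (conj ((cayleyToDisk ⟨1, by simp⟩ μ : Disk) : ℂ)) = conj (μ : ℂ) := fun μ => by
    have h3 : conj (1 + (μ : ℂ)) ≠ 0 := (map_ne_zero (starRingEnd ℂ)).2 (h1 μ)
    simp only [map_add, map_one] at h3
    simp only [cayleyToHalfPlane, cayleyToDisk, map_div₀, map_sub, map_add, map_one]
    field_simp
    ring
  have h4 : (μ : ℂ) + conj (l : ℂ) ≠ 0 := fun h => by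
    have := congrArg Complex.re h
    have := μ.2
    have := l.2
    simp at *
    linarith
  have h5 := h1 μ
  have h6 : conj (1 + (l : ℂ)) ≠ 0 := (map_ne_zero (starRingEnd ℂ)).2 (h1 l)
  simp only [map_add, map_one] at h6
  simp only [kernelHalfPlane, kernelDisk, SchurHalfPlane.toDisk, Matrix.of_apply, h2, smul_smul]
  congr 1
  simp only [cayleyToDisk, map_div₀, map_sub, map_add, map_one, map_inv₀]
  have h7 : (1 : ℂ) - (1 - μ) / (1 + μ) * ((1 - conj (l : ℂ)) / (1 + conj (l : ℂ)))
      = 2 * (μ + conj (l : ℂ)) / ((1 + μ) * (1 + conj (l : ℂ))) := by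
    field_simp
    ring
  rw [h7]
  field_simp

theorem kernelHalfPlane_sum_nonneg (φ : SchurHalfPlane U Y) (s : Finset RightHalfPlane)
    (g : RightHalfPlane → U) :
    0 ≤ (∑ i ∈ s, ∑ j ∈ s, ⟪g i, kernelHalfPlane φ i j (g j)⟫_ℂ).re := by
  have h := kernelDisk_sum_nonneg (φ.toDisk ⟨1, by simp⟩) s (cayleyToDisk ⟨1, by simp⟩)
    (fun i => conj (1 + (i : ℂ))⁻¹ • g i)
  have h2 : (∑ i ∈ s, ∑ j ∈ s, ⟪g i, kernelHalfPlane φ i j (g j)⟫_ℂ) = (2 : ℝ) *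
      ∑ i ∈ s, ∑ j ∈ s, ⟪conj (1 + (i : ℂ))⁻¹ • g i,
        kernelDisk (φ.toDisk ⟨1, by simp⟩) (cayleyToDisk ⟨1, by simp⟩ i)
          (cayleyToDisk ⟨1, by simp⟩ j) (conj (1 + (j : ℂ))⁻¹ • g j)⟫_ℂ := by
    simp only [Finset.mul_sum]
    refine Finset.sum_congr rfl fun i _ => Finset.sum_congr rfl fun j _ => ?_
    rw [kernelHalfPlane_eq]
    simp only [inner_smul_left, inner_smul_right, map_smul, _root_.smul_apply, conj_conj]
    push_cast
    ring
  rw [h2, Complex.re_ofReal_mul]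
  positivity

theorem kernelHalfPlane_posSemidef (φ : SchurHalfPlane U Y) : (kernelHalfPlane φ).PosSemidef := by
  have htfae := (RKHS.posSemidef_tfae (K := kernelHalfPlane φ)).out 0 2
  refine htfae.2 ⟨?_, fun v => ?_⟩
  · ext z w : 1
    simp only [Matrix.conjTranspose_apply, kernelHalfPlane, Matrix.of_apply, star_smul, star_sub,
      star_one, ContinuousLinearMap.star_eq_adjoint, ContinuousLinearMap.adjoint_comp,
      ContinuousLinearMap.adjoint_adjoint]
    simp [add_comm]
  · have := kernelHalfPlane_sum_nonneg φ v.support v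
    rw [Finset.sum_comm] at this
    rw [← RCLike.conj_re, Finsupp.sum]
    simpa [Finsupp.sum, map_sum] using this

instance (φ : SchurHalfPlane U Y) : Fact (kernelHalfPlane φ).PosSemidef :=
  ⟨kernelHalfPlane_posSemidef φ⟩

instance (ψ : SchurDisk U Y) : Fact (kernelDisk ψ).PosSemidef := ⟨kernelDisk_posSemidef ψ⟩

/-- The space `H_c` of functions on the right half-plane with reproducing kernel
`kernelHalfPlane φ`. -/
abbrev HcHalfPlane (φ : SchurHalfPlane U Y) : Type _ := RKHS.OfKernel (kernelHalfPlane φ)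

/-- The space of functions on the disk with reproducing kernel `kernelDisk ψ`. -/
abbrev HcDisk (ψ : SchurDisk U Y) : Type _ := RKHS.OfKernel (kernelDisk ψ)

/-- The operator `e_c(l)^*`, the adjoint of point evaluation at `l` on `H_c`. -/
def evalAdjoint (φ : SchurHalfPlane U Y) (l : RightHalfPlane) : U →L[ℂ] HcHalfPlane φ :=
  RKHS.kerFun (HcHalfPlane φ) l

end Spaces

/-! ### System nodes -/

section SystemNode

variable {X U Y : Type*} [NormedAddCommGroup X] [InnerProductSpace ℂ X]
  [NormedAddCommGroup U] [InnerProductSpace ℂ U] [NormedAddCommGroup Y] [InnerProductSpace ℂ Y]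

/-- The resolvent set of a (closed) operator `A`: all `μ` such that `μ - A` maps the domain of `A`
one-to-one onto the whole space. -/
def resolventPoints (A : X →ₗ.[ℂ] X) : Set ℂ :=
  {μ | Function.Bijective (μ • A.domain.subtype - A.toFun : A.domain →ₗ[ℂ] X)}

/-- The resolvent `(μ - A)⁻¹`, as a bijection from the space onto the domain of `A`. -/
def resolventMap (A : X →ₗ.[ℂ] X) {μ : ℂ} (hμ : μ ∈ resolventPoints A) : X ≃ₗ[ℂ] A.domain :=
  (LinearEquiv.ofBijective (μ • A.domain.subtype - A.toFun) hμ).symm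

/-- A strongly continuous semigroup of bounded operators. -/
structure IsC0Semigroup (T : ℝ≥0 → X →L[ℂ] X) : Prop where
  map_zero : T 0 = 1
  map_add : ∀ s t, T (s + t) = T s ∘L T t
  tendsto_zero : ∀ x, Tendsto (fun t => T t x) (𝓝[>] 0) (𝓝 x)

/-- `A` is the infinitesimal generator of `T`: its graph consists of all `(x, z)` such that
`(T t x - x) / t` tends to `z` as `t` decreases to zero. -/
def IsGenerator (A : X →ₗ.[ℂ] X) (T : ℝ≥0 → X →L[ℂ] X) : Prop :=
  ∀ x z : X, (x, z) ∈ A.graph ↔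
    Tendsto (fun t : ℝ≥0 => ((t : ℝ) : ℂ)⁻¹ • (T t x - x)) (𝓝[>] 0) (𝓝 z)

/-- The space `X` with the weaker norm `‖(β - A)⁻¹ x‖`. -/
def PreExtrapolation (A : X →ₗ.[ℂ] X) {β : ℂ} (_hβ : β ∈ resolventPoints A) : Type _ := X

instance (A : X →ₗ.[ℂ] X) {β : ℂ} (hβ : β ∈ resolventPoints A) :
    AddCommGroup (PreExtrapolation A hβ) := inferInstanceAs (AddCommGroup X)

instance (A : X →ₗ.[ℂ] X) {β : ℂ} (hβ : β ∈ resolventPoints A) :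
    Module ℂ (PreExtrapolation A hβ) := inferInstanceAs (Module ℂ X)

/-- The identity map from `X` to `PreExtrapolation A hβ`. -/
def toPreExtrapolation (A : X →ₗ.[ℂ] X) {β : ℂ} (hβ : β ∈ resolventPoints A) :
    X ≃ₗ[ℂ] PreExtrapolation A hβ := LinearEquiv.refl ℂ X

/-- The map `x ↦ (β - A)⁻¹ x` that defines the weaker norm. -/
def preExtrapolationMap (A : X →ₗ.[ℂ] X) {β : ℂ} (hβ : β ∈ resolventPoints A) :
    PreExtrapolation A hβ →ₗ[ℂ] X :=
  A.domain.subtype ∘ₗ ((toPreExtrapolation A hβ).symm.trans (resolventMap A hβ)).toLinearMap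

theorem preExtrapolationMap_injective (A : X →ₗ.[ℂ] X) {β : ℂ} (hβ : β ∈ resolventPoints A) :
    Function.Injective (preExtrapolationMap A hβ) :=
  Subtype.val_injective.comp ((toPreExtrapolation A hβ).symm.trans (resolventMap A hβ)).injective

instance (A : X →ₗ.[ℂ] X) {β : ℂ} (hβ : β ∈ resolventPoints A) :
    NormedAddCommGroup (PreExtrapolation A hβ) :=
  NormedAddCommGroup.induced _ X (preExtrapolationMap A hβ) (preExtrapolationMap_injective A hβ)

instance (A : X →ₗ.[ℂ] X) {β : ℂ} (hβ : β ∈ resolventPoints A) :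
    NormedSpace ℂ (PreExtrapolation A hβ) :=
  NormedSpace.induced ℂ (PreExtrapolation A hβ) X (preExtrapolationMap A hβ)

theorem norm_toPreExtrapolation (A : X →ₗ.[ℂ] X) {β : ℂ} (hβ : β ∈ resolventPoints A) (x : X) :
    ‖toPreExtrapolation A hβ x‖ = ‖(resolventMap A hβ x : X)‖ := rfl

/-- The extrapolation space `X₋₁`: the completion of `X` in the norm `‖(β - A)⁻¹ x‖`. -/
abbrev Extrapolation (A : X →ₗ.[ℂ] X) {β : ℂ} (hβ : β ∈ resolventPoints A) : Type _ :=
  UniformSpace.Completion (PreExtrapolation A hβ)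

/-- The inclusion of `X` into `X₋₁`. -/
def extrapolationIncl (A : X →ₗ.[ℂ] X) {β : ℂ} (hβ : β ∈ resolventPoints A) :
    X →ₗ[ℂ] Extrapolation A hβ :=
  (UniformSpace.Completion.toComplₗᵢ (𝕜 := ℂ) (E := PreExtrapolation A hβ)).toLinearMap ∘ₗ
    (toPreExtrapolation A hβ).toLinearMap

/-- The main operator `A x = A&B (x, 0)` of an operator `[A&B; C&D]`. -/
def mainOperator (S : X × U →ₗ.[ℂ] X × Y) : X →ₗ.[ℂ] X where
  domain := S.domain.comap (LinearMap.inl ℂ X U)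
  toFun := LinearMap.fst ℂ X Y ∘ₗ S.toFun ∘ₗ
    (LinearMap.inl ℂ X U).restrict (p := S.domain.comap (LinearMap.inl ℂ X U)) (q := S.domain)
      (fun _ hx => hx)

/-- The observation operator `C x = C&D (x, 0)` of an operator `[A&B; C&D]`. -/
def observation (S : X × U →ₗ.[ℂ] X × Y) : (mainOperator S).domain →ₗ[ℂ] Y :=
  LinearMap.snd ℂ X Y ∘ₗ S.toFun ∘ₗ
    (LinearMap.inl ℂ X U).restrict (p := S.domain.comap (LinearMap.inl ℂ X U)) (q := S.domain)
      (fun _ hx => hx)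

/-- `A'` and `B` are the continuous operators `A|_X : X → X₋₁` and `B : U → X₋₁` such that `A&B` is
the restriction of `[A|_X B]` to the domain of `[A&B; C&D]`, and this domain consists of all
`(x, u)` with `A|_X x + B u ∈ X`. -/
structure IsRiggedExtension (S : X × U →ₗ.[ℂ] X × Y) {β : ℂ}
    (hβ : β ∈ resolventPoints (mainOperator S))
    (A' : X →L[ℂ] Extrapolation (mainOperator S) hβ)
    (B : U →L[ℂ] Extrapolation (mainOperator S) hβ) : Prop where
  extends_op : ∀ p : S.domain,
    A' (p : X × U).1 + B (p : X × U).2 = extrapolationIncl (mainOperator S) hβ (S p).1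
  mem_domain_iff : ∀ p : X × U, p ∈ S.domain ↔
    A' p.1 + B p.2 ∈ LinearMap.range (extrapolationIncl (mainOperator S) hβ)

/-- System nodes on `(U, X, Y)`.  The norm of `X₋₁` depends on `β`, its topology does not. -/
structure IsSystemNode (S : X × U →ₗ.[ℂ] X × Y) : Prop where
  isClosed : S.IsClosed
  generator : ∃ T : ℝ≥0 → X →L[ℂ] X, IsC0Semigroup T ∧ IsGenerator (mainOperator S) T
  rigged : ∀ (β : ℂ) (hβ : β ∈ resolventPoints (mainOperator S)),
    ∃ A' B, IsRiggedExtension S hβ A' B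

/-- The operator `μ - A|_X` from `X` to `X₋₁`. -/
def subExtension {A : X →ₗ.[ℂ] X} {β : ℂ} {hβ : β ∈ resolventPoints A}
    (A' : X →L[ℂ] Extrapolation A hβ) (μ : ℂ) : X →ₗ[ℂ] Extrapolation A hβ :=
  μ • extrapolationIncl A hβ - A'.toLinearMap

/-- The operators `bA, bB, bC, bD` form the Cayley transform with parameter `α` of the system node `S`:
`bA = (conj α + A)(α - A)⁻¹`, `bB = √(2 re α) (α - A|_X)⁻¹ B`, `bC = √(2 re α) C (α - A)⁻¹`, and
`bD` is the value `C&D ((α - A|_X)⁻¹ B, 1)` at `α` of the transfer function. -/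
structure IsCayleyTransform (S : X × U →ₗ.[ℂ] X × Y) (α : ℂ)
    (bA : X →L[ℂ] X) (bB : U →L[ℂ] X) (bC : X →L[ℂ] Y) (bD : U →L[ℂ] Y) : Prop where
  isSystemNode : IsSystemNode S
  mem_res : α ∈ resolventPoints (mainOperator S)
  main_eq : ∀ x : X, bA x =
    conj α • (resolventMap (mainOperator S) mem_res x : X) +
      mainOperator S (resolventMap (mainOperator S) mem_res x)
  observation_eq : ∀ x : X, bC x =
    (√(2 * α.re) : ℂ) • observation S (resolventMap (mainOperator S) mem_res x)
  control_eq : ∀ (β : ℂ) (hβ : β ∈ resolventPoints (mainOperator S))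
    (A' : X →L[ℂ] Extrapolation (mainOperator S) hβ)
    (B : U →L[ℂ] Extrapolation (mainOperator S) hβ), IsRiggedExtension S hβ A' B →
    ∃ hbij : Function.Bijective (subExtension A' α), ∀ u : U,
      bB u = (√(2 * α.re) : ℂ) • (LinearEquiv.ofBijective _ hbij).symm (B u) ∧
      ∃ hmem : ((LinearEquiv.ofBijective _ hbij).symm (B u), u) ∈ S.domain,
        bD u = (S ⟨((LinearEquiv.ofBijective _ hbij).symm (B u), u), hmem⟩).2

/-- The block operator `[A B; C D]` between orthogonal direct sums of Hilbert spaces. -/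
def blockOperator (A : X →L[ℂ] X) (B : U →L[ℂ] X) (C : X →L[ℂ] Y) (D : U →L[ℂ] Y) :
    WithLp 2 (X × U) → WithLp 2 (X × Y) :=
  fun p => WithLp.toLp 2 (A p.fst + B p.snd, C p.fst + D p.snd)

end SystemNode

/-! ### The controllable energy-preserving model on the right half-plane -/

section Model

variable {U Y : Type*} [NormedAddCommGroup U] [InnerProductSpace ℂ U] [CompleteSpace U]
  [NormedAddCommGroup Y] [InnerProductSpace ℂ Y] [CompleteSpace Y]

/-- The linear span of all `((e_c(conj l)^* u, u), (l e_c(conj l)^* u, φ(l) u))`. -/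
def preGraph (φ : SchurHalfPlane U Y) :
    Submodule ℂ ((HcHalfPlane φ × U) × (HcHalfPlane φ × Y)) :=
  Submodule.span ℂ (Set.range fun p : RightHalfPlane × U =>
    ((evalAdjoint φ p.1.conj p.2, p.2), ((p.1 : ℂ) • evalAdjoint φ p.1.conj p.2, φ p.1 p.2)))

/-- The functional on `preGraph` that expresses scattering isometry. -/
def powerForm (φ : SchurHalfPlane U Y) (p : (HcHalfPlane φ × U) × (HcHalfPlane φ × Y)) :
    (HcHalfPlane φ × U) × (HcHalfPlane φ × Y) →L[ℂ] ℂ :=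
  (innerSL ℂ p.1.2) ∘L .snd ℂ _ _ ∘L .fst ℂ _ _ - (innerSL ℂ p.2.2) ∘L .snd ℂ _ _ ∘L .snd ℂ _ _
    - (innerSL ℂ p.2.1) ∘L .fst ℂ _ _ ∘L .fst ℂ _ _
    - (innerSL ℂ p.1.1) ∘L .fst ℂ _ _ ∘L .snd ℂ _ _

theorem powerForm_apply (φ : SchurHalfPlane U Y)
    (p q : (HcHalfPlane φ × U) × (HcHalfPlane φ × Y)) : powerForm φ p q =
      ⟪p.1.2, q.1.2⟫_ℂ - ⟪p.2.2, q.2.2⟫_ℂ - ⟪p.2.1, q.1.1⟫_ℂ - ⟪p.1.1, q.2.1⟫_ℂ := rfl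

theorem powerForm_symm (φ : SchurHalfPlane U Y)
    (p q : (HcHalfPlane φ × U) × (HcHalfPlane φ × Y)) (h : powerForm φ p q = 0) :
    powerForm φ q p = 0 := by
  have h2 := congrArg (starRingEnd ℂ) h
  simp only [powerForm_apply, map_sub, inner_conj_symm, map_zero] at h2 ⊢
  rw [← h2]
  ring

theorem powerForm_generator (φ : SchurHalfPlane U Y) (l μ : RightHalfPlane) (u v : U) :
    powerForm φ ((evalAdjoint φ l.conj u, u), ((l : ℂ) • evalAdjoint φ l.conj u, φ l u))
      ((evalAdjoint φ μ.conj v, v), ((μ : ℂ) • evalAdjoint φ μ.conj v, φ μ v)) = 0 := by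
  have hne : conj (l : ℂ) + (μ : ℂ) ≠ 0 := fun h => by
    have := congrArg Complex.re h
    have := μ.2
    have := l.2
    simp at *
    linarith
  have h1 : ⟪evalAdjoint φ l.conj u, evalAdjoint φ μ.conj v⟫_ℂ =
      (conj (l : ℂ) + (μ : ℂ))⁻¹ * (⟪u, v⟫_ℂ - ⟪φ l u, φ μ v⟫_ℂ) := by
    rw [evalAdjoint, RKHS.kerFun_inner, evalAdjoint, RKHS.kerFun_apply, RKHS.OfKernel.kernel_ofKernel]
    simp [kernelHalfPlane, RightHalfPlane.conj, inner_smul_right, inner_sub_right,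
      ContinuousLinearMap.adjoint_inner_right]
  simp only [powerForm_apply, inner_smul_left, inner_smul_right, h1]
  field_simp
  ring

theorem powerForm_closure (φ : SchurHalfPlane U Y)
    {p q : (HcHalfPlane φ × U) × (HcHalfPlane φ × Y)}
    (hp : p ∈ (preGraph φ).topologicalClosure) (hq : q ∈ (preGraph φ).topologicalClosure) :
    powerForm φ p q = 0 := by
  have key : ∀ p, (∀ (l : RightHalfPlane) (u : U), powerForm φ p
      ((evalAdjoint φ l.conj u, u), ((l : ℂ) • evalAdjoint φ l.conj u, φ l u)) = 0) →
      ∀ q ∈ (preGraph φ).topologicalClosure, powerForm φ p q = 0 := by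
    intro p hp q hq
    have : (preGraph φ).topologicalClosure ≤ (powerForm φ p).ker := by
      refine Submodule.topologicalClosure_minimal _ (Submodule.span_le.2 ?_)
        (powerForm φ p).isClosed_ker
      rintro _ ⟨⟨l, u⟩, rfl⟩
      exact hp l u
    exact this hq
  refine key p (fun l u => powerForm_symm φ _ _ (key _ (fun μ v => ?_) p hp)) q hq
  exact powerForm_generator φ l μ u v

theorem preGraph_closure_functional (φ : SchurHalfPlane U Y)
    (p : (HcHalfPlane φ × U) × (HcHalfPlane φ × Y)) (hp : p ∈ (preGraph φ).topologicalClosure)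
    (h0 : p.1 = 0) : p.2 = 0 := by
  have h1 := powerForm_closure φ hp hp
  have hy : p.2.2 = 0 := by
    simpa [powerForm_apply, h0] using h1
  have hz : p.2.1 = 0 := by
    refine RKHS.ext fun μ => ext_inner_right ℂ fun u => ?_
    have hg : ((evalAdjoint φ μ u, u), ((μ.conj : ℂ) • evalAdjoint φ μ u, φ μ.conj u)) ∈
        (preGraph φ).topologicalClosure := by
      refine (preGraph φ).le_topologicalClosure (Submodule.subset_span ⟨(μ.conj, u), ?_⟩)
      have : μ.conj.conj = μ := Subtype.ext (by simp [RightHalfPlane.conj])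
      simp [this]
    have h2 := powerForm_closure φ hp hg
    simp only [powerForm_apply, h0, hy] at h2
    simpa [evalAdjoint] using h2
  exact Prod.ext hz hy

/-- The canonical controllable energy-preserving model `[A&B; C&D]_c` of `φ`: the closure of the
linear operator determined by `(e_c(conj l)^* u, u) ↦ (l e_c(conj l)^* u, φ(l) u)`. -/
def controllableNode (φ : SchurHalfPlane U Y) : HcHalfPlane φ × U →ₗ.[ℂ] HcHalfPlane φ × Y :=
  (preGraph φ).topologicalClosure.toLinearPMap

theorem controllableNode_graph (φ : SchurHalfPlane U Y) :
    (controllableNode φ).graph = (preGraph φ).topologicalClosure :=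
  Submodule.toLinearPMap_graph_eq _ (preGraph_closure_functional φ)

/-- The operator `τ_{c,α} = C_c (α - A_c)⁻¹`. -/
def tau (φ : SchurHalfPlane U Y) {α : ℂ}
    (hα : α ∈ resolventPoints (mainOperator (controllableNode φ))) : HcHalfPlane φ →ₗ[ℂ] Y :=
  observation (controllableNode φ) ∘ₗ (resolventMap (mainOperator (controllableNode φ)) hα)

/-! ### The controllable isometric model on the disk -/

/-- The operators `A, B, C, D` form the controllable isometric de Branges-Rovnyak model of `ψ`.
Here `C g` is the unique vector with `⟪C g, y⟫ = ⟪g, z ↦ (ψ(conj z)^* - ψ(0)^*) y / z⟫` for all `y`,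
where the singularity at zero is removed by `dslope`. -/
structure IsControllableDiskModel (ψ : SchurDisk U Y) (A : HcDisk ψ →L[ℂ] HcDisk ψ)
    (B : U →L[ℂ] HcDisk ψ) (C : HcDisk ψ →L[ℂ] Y) (D : U →L[ℂ] Y) : Prop where
  main_eq : ∀ (g : HcDisk ψ) (z : Disk),
    A g z = (z : ℂ) • g z - (ψ (conj (z : ℂ))).adjoint (C g)
  control_eq : ∀ (u : U) (z : Disk), B u z = u - (ψ (conj (z : ℂ))).adjoint (ψ 0 u)
  observation_eq : ∀ y : Y, ∃ q : HcDisk ψ,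
    (∀ z : Disk, q z = dslope (fun w : ℂ => (ψ (conj w)).adjoint y) 0 z) ∧
      ∀ g : HcDisk ψ, ⟪C g, y⟫_ℂ = ⟪g, q⟫_ℂ
  feedthrough_eq : ∀ u : U, D u = ψ 0 u

/-- The map `(Ξ_α ξ)(μ) = √(2 re α) / (conj α + μ) ξ(z_α(μ))`. -/
def xi {V : Type*} [NormedAddCommGroup V] [NormedSpace ℂ V] (α : RightHalfPlane) (ξ : Disk → V)
    (μ : RightHalfPlane) : V :=
  ((√(2 * (α : ℂ).re) : ℂ) / (conj (α : ℂ) + μ)) • ξ (cayleyToDisk α μ)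

end Model

end DeBrangesRovnyak

end

open DeBrangesRovnyak
open scoped ComplexConjugate

/-!
The main operator `A_c` of the model is maximal dissipative. Scattering isometry of the graph
(`powerForm_closure`) gives, for every `((x, u), (z, y))` in it,
`‖α x - z‖² + 2 re α ‖u‖² = ‖conj α x + z‖² + 2 re α ‖y‖²`, so `A_c` is dissipative and the range of
`α - A_c` is closed. This range contains `(α - l) e_c(conj l)^* u` for every `l`, being the image of
the difference of the generators of the graph at `l` and `α`; a function orthogonal to it vanishes
off the point `conj α`, hence everywhere by continuity (`range_resolventEquation`).

Mathlib has no theorem on generation of semigroups, so the Hille-Yosida theorem for contraction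
semigroups on a Hilbert space is proved here by the Yosida approximation
(`IsMaximalDissipative.exists_isGenerator`). The remaining part of the system node structure is
formal. The resolvent `(β - A)⁻¹` extends to a unitary map from `X₋₁` onto `X`, which determines
`A|_X`, and the generator at one point `ν` forces the control operator to be
`(ν - A|_X) e_c(conj ν)^*` (`exists_isRiggedExtension`). Hence `(α - A|_X)⁻¹ B` is `e_c(conj α)^*`,
and the displayed identity is the isometry of the Cayley transform.

Pairing an element of the graph with the generator at `conj μ` yields
`z(μ) = u - φ(conj μ)^* y - μ x(μ)` (`apply_of_mem_graph`), from which the formula for the main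
operator of the Cayley transform follows. The operator `Ξ` is unitary because the two kernels differ
by the factor `c(μ) conj (c(l))` with `c(μ) = √(2 re α) / (α + μ)` (`exists_weightedComposition`,
`kernelHalfPlane_eq_weight`). The disk model is the transport of the Cayley transform along `Ξ`. Its
observation operator is identified on kernel functions (`tau_evalAdjoint`), and the value of the
difference quotient at zero is obtained by continuity (`adjoint_apply_eq_dslope`).
-/

noncomputable section

open Complex Metric Filter Topology
open scoped ComplexConjugate InnerProductSpace NNReal

namespace DeBrangesRovnyak

/-! ### Maximal dissipative operators -/

section Resolvent

variable {X : Type*} [NormedAddCommGroup X] [InnerProductSpace ℂ X]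

theorem re_inner_self_eq_norm_sq (x : X) : (⟪x, x⟫_ℂ).re = ‖x‖ ^ 2 :=
  inner_self_eq_norm_sq (𝕜 := ℂ) x

theorem smul_resolventMap_sub (A : X →ₗ.[ℂ] X) {μ : ℂ} (hμ : μ ∈ resolventPoints A) (x : X) :
    μ • (resolventMap A hμ x : X) - A (resolventMap A hμ x) = x :=
  (LinearEquiv.ofBijective (μ • A.domain.subtype - A.toFun) hμ).apply_symm_apply x

theorem resolventMap_apply_eq (A : X →ₗ.[ℂ] X) {μ : ℂ} (hμ : μ ∈ resolventPoints A) {w : X}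
    (x : A.domain) (h : μ • (x : X) - A x = w) : resolventMap A hμ w = x := by
  subst h
  exact (LinearEquiv.ofBijective (μ • A.domain.subtype - A.toFun) hμ).symm_apply_apply x

theorem resolventMap_sub (A : X →ₗ.[ℂ] X) {μ l : ℂ} (hμ : μ ∈ resolventPoints A)
    (hl : l ∈ resolventPoints A) (x : X) :
    (resolventMap A hμ x : X) - resolventMap A hl x =
      (l - μ) • (resolventMap A hμ (resolventMap A hl x) : X) := by
  have h : resolventMap A hμ ((l - μ) • (resolventMap A hl x : X)) =
      resolventMap A hμ x - resolventMap A hl x := by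
    refine resolventMap_apply_eq A hμ _ ?_
    have h1 := smul_resolventMap_sub A hμ x
    have h2 := smul_resolventMap_sub A hl x
    rw [LinearPMap.map_sub, Submodule.coe_sub, smul_sub, sub_sub_sub_comm, h1, sub_smul]
    nth_rewrite 1 [← h2]
    abel
  rw [← Submodule.coe_sub, ← h, map_smul, Submodule.coe_smul]

theorem resolventMap_comm (A : X →ₗ.[ℂ] X) {μ l : ℂ} (hμ : μ ∈ resolventPoints A)
    (hl : l ∈ resolventPoints A) (x : X) :
    (resolventMap A hμ (resolventMap A hl x) : X) = resolventMap A hl (resolventMap A hμ x) := by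
  rcases eq_or_ne l μ with rfl | hne
  · rfl
  · have h1 := resolventMap_sub A hμ hl x
    have h2 := resolventMap_sub A hl hμ x
    rw [← neg_sub, h1, ← neg_smul, neg_sub] at h2
    exact smul_right_injective X (sub_ne_zero.2 hne.symm) h2

theorem re_mul_norm_sq_le {x z : X} (h : (⟪z, x⟫_ℂ).re ≤ 0) (μ : ℂ) :
    μ.re * ‖x‖ ^ 2 ≤ (⟪μ • x - z, x⟫_ℂ).re := by
  have h2 := re_inner_self_eq_norm_sq x
  have h3 := inner_self_im (𝕜 := ℂ) x
  rw [RCLike.im_to_complex] at h3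
  rw [inner_sub_left, inner_smul_left, Complex.sub_re, Complex.mul_re, h2, h3]
  simp only [Complex.conj_re, mul_zero, sub_zero]
  linarith

theorem re_mul_norm_le {x z : X} (h : (⟪z, x⟫_ℂ).re ≤ 0) (μ : ℂ) :
    μ.re * ‖x‖ ≤ ‖μ • x - z‖ := by
  have h1 := re_mul_norm_sq_le h μ
  have h2 : (⟪μ • x - z, x⟫_ℂ).re ≤ ‖μ • x - z‖ * ‖x‖ :=
    (Complex.re_le_norm _).trans (norm_inner_le_norm _ _)
  rcases (norm_nonneg x).eq_or_lt' with h0 | h0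
  · rw [h0]; simp
  · refine le_of_mul_le_mul_right ?_ h0
    nlinarith

/-- An operator `A` is maximal dissipative if `re ⟪A x, x⟫ ≤ 0` on its domain and `μ - A` is onto
for every `μ` in the right half-plane. -/
structure IsMaximalDissipative (A : X →ₗ.[ℂ] X) : Prop where
  re_inner_nonpos : ∀ x : A.domain, (⟪A x, (x : X)⟫_ℂ).re ≤ 0
  exists_eq : ∀ μ : ℂ, 0 < μ.re → ∀ w : X, ∃ x : A.domain, μ • (x : X) - A x = w

namespace IsMaximalDissipative

variable {A : X →ₗ.[ℂ] X} (hA : IsMaximalDissipative A)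
include hA

theorem mem_resolventPoints {μ : ℂ} (hμ : 0 < μ.re) : μ ∈ resolventPoints A := by
  refine ⟨(injective_iff_map_eq_zero _).2 fun x hx => ?_, fun w => hA.exists_eq μ hμ w⟩
  have h := re_mul_norm_le (hA.re_inner_nonpos x) μ
  have hx' : μ • (x : X) - A x = 0 := hx
  rw [hx', norm_zero] at h
  have : ‖(x : X)‖ ≤ 0 := by
    by_contra hc
    push Not at hc
    nlinarith [mul_pos hμ hc]
  exact Subtype.ext (norm_le_zero_iff.1 this)

theorem norm_resolventMap_le {μ : ℂ} (hμ : 0 < μ.re) (x : X) :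
    ‖(resolventMap A (hA.mem_resolventPoints hμ) x : X)‖ ≤ μ.re⁻¹ * ‖x‖ := by
  have h := re_mul_norm_le
    (hA.re_inner_nonpos (resolventMap A (hA.mem_resolventPoints hμ) x)) μ
  rw [smul_resolventMap_sub] at h
  rwa [inv_mul_eq_div, le_div_iff₀ hμ, mul_comm]

/-- If `w` is orthogonal to the domain and `w = (1 - A) x`, then pairing with `x` gives `x = 0`. -/
theorem dense_domain [CompleteSpace X] : Dense (A.domain : Set X) := by
  rw [Submodule.dense_iff_topologicalClosure_eq_top, Submodule.topologicalClosure_eq_top_iff,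
    Submodule.eq_bot_iff]
  intro w hw
  obtain ⟨x, rfl⟩ := hA.exists_eq 1 (by simp) w
  have h := re_mul_norm_sq_le (hA.re_inner_nonpos x) 1
  rw [Submodule.inner_left_of_mem_orthogonal x.2 hw] at h
  have h0 : (x : X) = 0 := by
    have : ‖(x : X)‖ ^ 2 ≤ 0 := by simpa using h
    simpa using le_antisymm this (sq_nonneg _)
  have hx : x = 0 := Subtype.ext h0
  rw [hx]; simp

/-- The resolvent `(μ - A)⁻¹` as a bounded operator. -/
def resolvent {μ : ℂ} (hμ : 0 < μ.re) : X →L[ℂ] X :=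
  (A.domain.subtype ∘ₗ (resolventMap A (hA.mem_resolventPoints hμ)).toLinearMap).mkContinuous
    μ.re⁻¹ (hA.norm_resolventMap_le hμ)

theorem resolvent_apply {μ : ℂ} (hμ : 0 < μ.re) (x : X) :
    hA.resolvent hμ x = resolventMap A (hA.mem_resolventPoints hμ) x := rfl

end IsMaximalDissipative

end Resolvent

/-! ### Exponentials of bounded dissipative operators -/

section Exponential

variable {X : Type*} [NormedAddCommGroup X] [InnerProductSpace ℂ X] [CompleteSpace X]

theorem hasDerivAt_exp_ofReal_smul (B : X →L[ℂ] X) (t : ℝ) :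
    HasDerivAt (fun s : ℝ => NormedSpace.exp ((s : ℂ) • B)) (NormedSpace.exp ((t : ℂ) • B) * B) t :=
  ((hasDerivAt_exp_smul_const (𝕂 := ℂ) B (t : ℂ)).scomp t
    Complex.ofRealCLM.hasDerivAt).congr_deriv (by simp)

theorem hasDerivAt_exp_ofReal_smul_apply (B : X →L[ℂ] X) (x : X) (t : ℝ) :
    HasDerivAt (fun s : ℝ => NormedSpace.exp ((s : ℂ) • B) x)
      (NormedSpace.exp ((t : ℂ) • B) (B x)) t :=
  ((ContinuousLinearMap.apply ℂ X x).restrictScalars ℝ).hasFDerivAt.comp_hasDerivAt t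
    (hasDerivAt_exp_ofReal_smul B t)

theorem norm_exp_smul_apply_le {B : X →L[ℂ] X} (hB : ∀ x, (⟪B x, x⟫_ℂ).re ≤ 0) {t : ℝ}
    (ht : 0 ≤ t) (x : X) : ‖NormedSpace.exp ((t : ℂ) • B) x‖ ≤ ‖x‖ := by
  let _ : InnerProductSpace ℝ X := InnerProductSpace.complexToReal
  have hd : ∀ s : ℝ, HasDerivAt (fun s : ℝ => ‖NormedSpace.exp ((s : ℂ) • B) x‖ ^ 2)
      (2 * ⟪NormedSpace.exp ((s : ℂ) • B) x, NormedSpace.exp ((s : ℂ) • B) (B x)⟫_ℝ) s :=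
    fun s => (hasDerivAt_exp_ofReal_smul_apply B x s).norm_sq
  have hanti : Antitone fun s : ℝ => ‖NormedSpace.exp ((s : ℂ) • B) x‖ ^ 2 := by
    refine antitone_of_deriv_nonpos (fun s => (hd s).differentiableAt) fun s => ?_
    rw [(hd s).deriv]
    have hc : Commute (NormedSpace.exp ((s : ℂ) • B)) B :=
      (((Commute.refl B).smul_left (s : ℂ)).exp_left)
    have hc' : NormedSpace.exp ((s : ℂ) • B) (B x) = B (NormedSpace.exp ((s : ℂ) • B) x) :=
      DFunLike.congr_fun hc.eq x
    rw [hc', real_inner_comm]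
    have := hB (NormedSpace.exp ((s : ℂ) • B) x)
    have h2 : ⟪B (NormedSpace.exp ((s : ℂ) • B) x), NormedSpace.exp ((s : ℂ) • B) x⟫_ℝ =
      (⟪B (NormedSpace.exp ((s : ℂ) • B) x), NormedSpace.exp ((s : ℂ) • B) x⟫_ℂ).re := rfl
    rw [h2]
    linarith
  have h := hanti ht
  simp only [Complex.ofReal_zero, zero_smul, NormedSpace.exp_zero] at h
  exact le_of_sq_le_sq h (norm_nonneg _)
  
/-- The difference is estimated by differentiating `exp (s B) exp ((t - s) C) x` in `s`. -/
theorem norm_exp_smul_sub_exp_smul_le {B C : X →L[ℂ] X} (hB : ∀ x, (⟪B x, x⟫_ℂ).re ≤ 0)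
    (hC : ∀ x, (⟪C x, x⟫_ℂ).re ≤ 0) (hBC : Commute B C) {t : ℝ} (ht : 0 ≤ t) (x : X) :
    ‖NormedSpace.exp ((t : ℂ) • B) x - NormedSpace.exp ((t : ℂ) • C) x‖ ≤ t * ‖B x - C x‖ := by
  have hd : ∀ s : ℝ, HasDerivAt
      (fun s : ℝ => NormedSpace.exp ((s : ℂ) • B) (NormedSpace.exp (((t - s : ℝ) : ℂ) • C) x))
      (NormedSpace.exp ((s : ℂ) • B) (NormedSpace.exp (((t - s : ℝ) : ℂ) • C) (B x - C x))) s := by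
    intro s
    have h2 := (hasDerivAt_exp_ofReal_smul_apply C x (t - s)).scomp s ((hasDerivAt_id s).const_sub t)
    have h3 : HasDerivAt (fun s : ℝ => (NormedSpace.exp ((s : ℂ) • B)).restrictScalars ℝ)
        ((NormedSpace.exp ((s : ℂ) • B) * B).restrictScalars ℝ) s :=
      (ContinuousLinearMap.restrictScalarsL ℂ X X ℝ ℝ).hasFDerivAt.comp_hasDerivAt s
        (hasDerivAt_exp_ofReal_smul B s)
    refine (h3.clm_apply h2).congr_deriv ?_
    have hc : Commute B (NormedSpace.exp (((t - s : ℝ) : ℂ) • C)) :=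
      (hBC.smul_right _).exp_right
    have hc' : B (NormedSpace.exp (((t - s : ℝ) : ℂ) • C) x) =
        NormedSpace.exp (((t - s : ℝ) : ℂ) • C) (B x) := DFunLike.congr_fun hc.eq x
    change NormedSpace.exp ((s : ℂ) • B) (B (NormedSpace.exp (((t - s : ℝ) : ℂ) • C) x)) +
      NormedSpace.exp ((s : ℂ) • B) ((-1 : ℝ) • NormedSpace.exp (((t - s : ℝ) : ℂ) • C) (C x)) = _
    rw [hc', ← map_add, map_sub, neg_one_smul, ← sub_eq_add_neg]
  have h := norm_image_sub_le_of_norm_deriv_le_segment' (a := 0) (b := t) (C := ‖B x - C x‖)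
    (fun s _ => (hd s).hasDerivWithinAt)
    (fun s hs => (norm_exp_smul_apply_le hB hs.1 _).trans
      (norm_exp_smul_apply_le hC (sub_nonneg.2 hs.2.le) _)) t ⟨ht, le_rfl⟩
  simpa [mul_comm] using h

end Exponential

/-! ### Generation of contraction semigroups -/

section Dense

variable {ι X : Type*} [NormedAddCommGroup X] [NormedSpace ℂ X]

theorem tendsto_id_of_contraction_of_dense {l : Filter ι} {F : ι → X →L[ℂ] X}
    (hF : ∀ᶠ i in l, ∀ x, ‖F i x‖ ≤ ‖x‖) {s : Set X} (hs : Dense s)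
    (h : ∀ x ∈ s, Tendsto (fun i => F i x) l (𝓝 x)) (x : X) :
    Tendsto (fun i => F i x) l (𝓝 x) := by
  rw [Metric.tendsto_nhds]
  intro ε hε
  obtain ⟨y, hy, hxy⟩ := Metric.mem_closure_iff.1 (hs x) (ε / 3) (by positivity)
  filter_upwards [hF, Metric.tendsto_nhds.1 (h y hy) (ε / 3) (by positivity)] with i h1 h2
  have h3 := h1 (x - y)
  rw [map_sub, ← dist_eq_norm, ← dist_eq_norm] at h3
  calc dist (F i x) x ≤ dist (F i x) (F i y) + dist (F i y) y + dist y x := dist_triangle4 _ _ _ _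
    _ < ε := by rw [dist_comm y x]; linarith

theorem cauchySeq_of_contraction_of_dense {F : ℕ → X →L[ℂ] X}
    (hF : ∀ n x, ‖F n x‖ ≤ ‖x‖) {s : Set X} (hs : Dense s)
    (h : ∀ x ∈ s, CauchySeq fun n => F n x) (x : X) : CauchySeq fun n => F n x := by
  rw [Metric.cauchySeq_iff]
  intro ε hε
  obtain ⟨y, hy, hxy⟩ := Metric.mem_closure_iff.1 (hs x) (ε / 3) (by positivity)
  obtain ⟨N, hN⟩ := Metric.cauchySeq_iff.1 (h y hy) (ε / 3) (by positivity)
  refine ⟨N, fun m hm n hn => ?_⟩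
  have h3 : ∀ n, dist (F n x) (F n y) < ε / 3 := fun n => by
    refine lt_of_le_of_lt ?_ hxy
    rw [dist_eq_norm, ← map_sub, dist_eq_norm]
    exact hF n _
  calc dist (F m x) (F n x) ≤ dist (F m x) (F m y) + dist (F m y) (F n y) + dist (F n y) (F n x) :=
        dist_triangle4 _ _ _ _
    _ < ε := by
        have := h3 m
        have := h3 n
        have := hN m hm n hn
        rw [dist_comm (F n y)]
        linarith

end Dense

namespace IsMaximalDissipative

variable {X : Type*} [NormedAddCommGroup X] [InnerProductSpace ℂ X]
  {A : X →ₗ.[ℂ] X} (hA : IsMaximalDissipative A)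
include hA

/-- The bounded operators `c A (c - A)⁻¹ = c (c (c - A)⁻¹ - 1)` with `c = n + 1`, which approximate
`A` on its domain. -/
def yosida (n : ℕ) : X →L[ℂ] X :=
  ((n : ℂ) + 1) • (((n : ℂ) + 1) •
    hA.resolvent (μ := (n : ℂ) + 1) (by simp; positivity) - 1)

theorem commute_resolvent {μ l : ℂ} (hμ : 0 < μ.re) (hl : 0 < l.re) :
    Commute (hA.resolvent hμ) (hA.resolvent hl) :=
  ContinuousLinearMap.ext fun x =>
    resolventMap_comm A (hA.mem_resolventPoints hμ) (hA.mem_resolventPoints hl) x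

theorem commute_yosida (n m : ℕ) : Commute (hA.yosida n) (hA.yosida m) := by
  refine Commute.smul_left (Commute.smul_right ?_ _) _
  refine Commute.sub_left (Commute.sub_right ?_ (Commute.one_right _)) (Commute.one_left _)
  exact ((hA.commute_resolvent _ _).smul_right _).smul_left _

theorem re_inner_yosida_nonpos (n : ℕ) (x : X) : (⟪hA.yosida n x, x⟫_ℂ).re ≤ 0 := by
  have hc : 0 < ((n : ℂ) + 1).re := by simp; positivity
  obtain ⟨p, hp⟩ := hA.exists_eq _ hc x
  have hR : hA.resolvent hc x = p := by
    rw [resolvent_apply, resolventMap_apply_eq A _ p hp]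
  have hy : hA.yosida n x = ((n : ℂ) + 1) • A p := by
    change ((n : ℂ) + 1) • (((n : ℂ) + 1) • hA.resolvent hc x - x) = _
    rw [hR]
    nth_rewrite 1 [← hp]
    rw [sub_sub_cancel]
  have hcc : conj ((n : ℂ) + 1) = ((n + 1 : ℝ) : ℂ) := by simp
  have hcc' : ((n : ℂ) + 1) = ((n + 1 : ℝ) : ℂ) := by simp
  have h1 := hA.re_inner_nonpos p
  rw [hy, ← hp, inner_smul_left, inner_sub_right, inner_smul_right, hcc, hcc',
    Complex.re_ofReal_mul, Complex.sub_re, Complex.re_ofReal_mul, re_inner_self_eq_norm_sq]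
  have hn : (0 : ℝ) ≤ n + 1 := by positivity
  exact mul_nonpos_of_nonneg_of_nonpos hn (by nlinarith [sq_nonneg ‖A p‖])

theorem yosida_apply (n : ℕ) (x : A.domain) :
    hA.yosida n x = ((n : ℂ) + 1) •
      hA.resolvent (μ := (n : ℂ) + 1) (by simp; positivity) (A x) := by
  have hc : 0 < ((n : ℂ) + 1).re := by simp; positivity
  have hR : hA.resolvent hc (((n : ℂ) + 1) • (x : X) - A x) = x := by
    rw [resolvent_apply, resolventMap_apply_eq A _ x rfl]
  change ((n : ℂ) + 1) • (((n : ℂ) + 1) • hA.resolvent hc x - x) = _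
  nth_rewrite 2 [← hR]
  rw [map_sub, map_smul, sub_sub_cancel]

theorem norm_smul_resolvent_le (n : ℕ) (x : X) : ‖((n : ℂ) + 1) •
      hA.resolvent (μ := (n : ℂ) + 1) (by simp; positivity) x‖ ≤ ‖x‖ := by
  have hc : 0 < ((n : ℂ) + 1).re := by simp; positivity
  have h := hA.norm_resolventMap_le hc x
  have hcc' : ((n : ℂ) + 1) = ((n + 1 : ℝ) : ℂ) := by simp
  have hn : (0 : ℝ) < n + 1 := by positivity
  have h2 : ‖(n : ℂ) + 1‖ = n + 1 := by
    rw [hcc', Complex.norm_real, Real.norm_of_nonneg hn.le]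
  rw [norm_smul, h2, resolvent_apply]
  refine (mul_le_mul_of_nonneg_left h hn.le).trans_eq ?_
  simp only [Complex.add_re, Complex.natCast_re, Complex.one_re]
  field_simp

variable [CompleteSpace X]

theorem tendsto_smul_resolvent (x : X) : Tendsto (fun n : ℕ => ((n : ℂ) + 1) •
      hA.resolvent (μ := (n : ℂ) + 1) (by simp; positivity) x) atTop (𝓝 x) := by
  refine tendsto_id_of_contraction_of_dense (F := fun n : ℕ => ((n : ℂ) + 1) •
      hA.resolvent (μ := (n : ℂ) + 1) (by simp; positivity))
    (Eventually.of_forall fun n => hA.norm_smul_resolvent_le n) hA.dense_domain ?_ x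
  intro x hx
  rw [tendsto_iff_norm_sub_tendsto_zero]
  have hlim : Tendsto (fun n : ℕ => (n + 1 : ℝ)⁻¹ * ‖A ⟨x, hx⟩‖) atTop (𝓝 0) := by
    simpa [one_div] using
      (tendsto_one_div_add_atTop_nhds_zero_nat (𝕜 := ℝ)).mul_const ‖A ⟨x, hx⟩‖
  refine squeeze_zero (fun _ => norm_nonneg _) (fun n => ?_) hlim
  have hc : 0 < ((n : ℂ) + 1).re := by simp; positivity
  have hR : hA.resolvent hc (((n : ℂ) + 1) • x - A ⟨x, hx⟩) = x := by
    rw [resolvent_apply, resolventMap_apply_eq A _ ⟨x, hx⟩ rfl]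
  have h : ((n : ℂ) + 1) • hA.resolvent hc x - x = hA.resolvent hc (A ⟨x, hx⟩) := by
    nth_rewrite 2 [← hR]
    rw [map_sub, map_smul, sub_sub_cancel]
  change ‖((n : ℂ) + 1) • hA.resolvent hc x - x‖ ≤ _
  rw [h]
  simpa [resolvent_apply] using hA.norm_resolventMap_le hc (A ⟨x, hx⟩)

theorem tendsto_yosida (x : A.domain) :
    Tendsto (fun n => hA.yosida n x) atTop (𝓝 (A x)) := by
  simp only [yosida_apply]
  exact hA.tendsto_smul_resolvent (A x)

theorem exists_tendsto_exp (t : ℝ≥0) : ∃ T : X →L[ℂ] X, ∀ x,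
    Tendsto (fun n => NormedSpace.exp (((t : ℝ) : ℂ) • hA.yosida n) x) atTop (𝓝 (T x)) := by
  have hc : ∀ x, CauchySeq fun n => NormedSpace.exp (((t : ℝ) : ℂ) • hA.yosida n) x := by
    refine cauchySeq_of_contraction_of_dense
      (fun n x => norm_exp_smul_apply_le (hA.re_inner_yosida_nonpos n) t.2 x) hA.dense_domain ?_
    intro x hx
    have h1 := (hA.tendsto_yosida ⟨x, hx⟩).cauchySeq
    rw [Metric.cauchySeq_iff] at h1 ⊢
    intro ε hε
    have ht : (0 : ℝ) < t + 1 := by positivity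
    obtain ⟨N, hN⟩ := h1 (ε / (t + 1)) (by positivity)
    refine ⟨N, fun m hm n hn => ?_⟩
    have h2 := hN m hm n hn
    rw [lt_div_iff₀ ht] at h2
    have h3 := norm_exp_smul_sub_exp_smul_le (hA.re_inner_yosida_nonpos m)
      (hA.re_inner_yosida_nonpos n) (hA.commute_yosida m n) t.2 x
    rw [← dist_eq_norm, ← dist_eq_norm] at h3
    refine lt_of_le_of_lt h3 ?_
    have h4 : (0 : ℝ) ≤ dist (hA.yosida m x) (hA.yosida n x) := dist_nonneg
    change dist (hA.yosida m x) (hA.yosida n x) * _ < _ at h2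
    change (t : ℝ) * _ < _
    linarith
  choose T hT using fun x => cauchySeq_tendsto_of_complete (hc x)
  exact ⟨continuousLinearMapOfTendsto _ (tendsto_pi_nhds.2 hT), hT⟩

/-- The Hille-Yosida theorem for contraction semigroups on Hilbert spaces: the exponentials of the
Yosida approximations converge strongly to a semigroup generated by `A`. -/
theorem exists_isGenerator :
    ∃ T : ℝ≥0 → X →L[ℂ] X, IsC0Semigroup T ∧ IsGenerator A T := by
  choose T hT using hA.exists_tendsto_exp
  have hexp : ∀ (n : ℕ) (t : ℝ≥0) (x : X),
      ‖NormedSpace.exp (((t : ℝ) : ℂ) • hA.yosida n) x‖ ≤ ‖x‖ := fun n t x =>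
    norm_exp_smul_apply_le (hA.re_inner_yosida_nonpos n) t.2 x
  have hnorm : ∀ t x, ‖T t x‖ ≤ ‖x‖ := fun t x =>
    le_of_tendsto (hT t x).norm (Eventually.of_forall fun n => hexp n t x)
  have hdiff : ∀ (t : ℝ≥0) (x : A.domain) (n : ℕ),
      ‖T t x - NormedSpace.exp (((t : ℝ) : ℂ) • hA.yosida n) x‖ ≤ t * ‖A x - hA.yosida n x‖ := by
    intro t x n
    refine le_of_tendsto_of_tendsto ((hT t x).sub_const _).norm
      (((hA.tendsto_yosida x).sub_const _).norm.const_mul _) (Eventually.of_forall fun m => ?_)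
    exact norm_exp_smul_sub_exp_smul_le (hA.re_inner_yosida_nonpos m)
      (hA.re_inner_yosida_nonpos n) (hA.commute_yosida m n) t.2 x
  have hderiv : ∀ x : A.domain,
      Tendsto (fun t : ℝ≥0 => ((t : ℝ) : ℂ)⁻¹ • (T t x - x)) (𝓝[>] 0) (𝓝 (A x)) := by
    intro x
    rw [Metric.tendsto_nhds]
    intro ε hε
    obtain ⟨n, hn⟩ := (Metric.tendsto_nhds.1 (hA.tendsto_yosida x) (ε / 3) (by positivity)).exists
    have h1 := (hasDerivAt_exp_ofReal_smul_apply (hA.yosida n) x 0).tendsto_slope_zero_right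
    have h2 : Tendsto (fun t : ℝ≥0 => (t : ℝ)) (𝓝[>] 0) (𝓝[>] 0) := by
      refine tendsto_nhdsWithin_iff.2 ⟨?_, ?_⟩
      · exact tendsto_nhdsWithin_of_tendsto_nhds (NNReal.continuous_coe.tendsto' _ _ rfl)
      · filter_upwards [self_mem_nhdsWithin] with t ht using NNReal.coe_pos.2 ht
    have h3 := h1.comp h2
    simp only [Complex.ofReal_zero, zero_smul, NormedSpace.exp_zero, zero_add] at h3
    filter_upwards [self_mem_nhdsWithin, Metric.tendsto_nhds.1 h3 (ε / 3) (by positivity)]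
      with t ht h4
    have ht' : (0 : ℝ) < t := NNReal.coe_pos.2 ht
    have h5 : dist (((t : ℝ) : ℂ)⁻¹ • (T t x - x)) (((t : ℝ) : ℂ)⁻¹ •
        (NormedSpace.exp (((t : ℝ) : ℂ) • hA.yosida n) x - x)) ≤ ‖A x - hA.yosida n x‖ := by
      rw [dist_eq_norm, ← smul_sub, sub_sub_sub_cancel_right, norm_smul, norm_inv,
        Complex.norm_real, Real.norm_of_nonneg ht'.le, inv_mul_le_iff₀ ht']
      exact hdiff t x n
    rw [← dist_eq_norm, dist_comm] at h5
    have h6 : dist (((t : ℝ) : ℂ)⁻¹ • (NormedSpace.exp (((t : ℝ) : ℂ) • hA.yosida n) (x : X) - x))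
        (hA.yosida n x) < ε / 3 := by
      convert h4 using 1
      simp [← Complex.ofReal_inv, Function.comp]
    rw [dist_comm] at h5
    have h7 := dist_triangle4 (((t : ℝ) : ℂ)⁻¹ • (T t x - x)) (((t : ℝ) : ℂ)⁻¹ •
        (NormedSpace.exp (((t : ℝ) : ℂ) • hA.yosida n) (x : X) - x)) (hA.yosida n x) (A x)
    rw [dist_comm (A x)] at h5
    linarith
  have hpos : ∀ᶠ t : ℝ≥0 in 𝓝[>] 0, 0 < t := self_mem_nhdsWithin
  refine ⟨T, ⟨?_, ?_, ?_⟩, ?_⟩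
  · ext x
    refine tendsto_nhds_unique (hT 0 x) ?_
    simp
  · intro s t
    ext x
    refine tendsto_nhds_unique (hT (s + t) x) ?_
    have h1 : ∀ n, NormedSpace.exp ((((s + t : ℝ≥0) : ℝ) : ℂ) • hA.yosida n) x =
        NormedSpace.exp (((s : ℝ) : ℂ) • hA.yosida n) (T t x) +
          NormedSpace.exp (((s : ℝ) : ℂ) • hA.yosida n)
            (NormedSpace.exp (((t : ℝ) : ℂ) • hA.yosida n) x - T t x) := by
      intro n
      let _ : NormedAlgebra ℚ (X →L[ℂ] X) := NormedAlgebra.restrictScalars ℚ ℂ _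
      rw [NNReal.coe_add, Complex.ofReal_add, add_smul, NormedSpace.exp_add_of_commute
        (((Commute.refl _).smul_left _).smul_right _), map_sub, add_sub_cancel]
      rfl
    simp only [h1]
    have h2 : Tendsto (fun n => NormedSpace.exp (((s : ℝ) : ℂ) • hA.yosida n)
        (NormedSpace.exp (((t : ℝ) : ℂ) • hA.yosida n) x - T t x)) atTop (𝓝 0) :=
      squeeze_zero_norm (fun n => hexp n s _)
        (tendsto_iff_norm_sub_tendsto_zero.1 (hT t x))
    simpa using (hT s (T t x)).add h2
  · refine tendsto_id_of_contraction_of_dense (Eventually.of_forall hnorm) hA.dense_domain ?_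
    intro x hx
    have h1 : Tendsto (fun t : ℝ≥0 => ((t : ℝ) : ℂ)) (𝓝[>] 0) (𝓝 0) :=
      tendsto_nhdsWithin_of_tendsto_nhds
        ((Complex.continuous_ofReal.comp NNReal.continuous_coe).tendsto' _ _ (by simp))
    have h2 := (h1.smul (hderiv ⟨x, hx⟩)).add_const x
    rw [zero_smul, zero_add] at h2
    refine h2.congr' ?_
    filter_upwards [hpos] with t ht
    have : ((t : ℝ) : ℂ) ≠ 0 := by exact_mod_cast ht.ne'
    rw [smul_inv_smul₀ this, sub_add_cancel]
  · -- the generator of `T` is a dissipative extension of `A`, hence equal to `A`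
    intro x z
    refine ⟨fun h => ?_, fun h => ?_⟩
    · obtain ⟨p, rfl, rfl⟩ := (LinearPMap.mem_graph_iff A).1 h
      exact hderiv p
    · obtain ⟨p, hp⟩ := hA.exists_eq 1 (by simp) (x - z)
      rw [one_smul] at hp
      have h1 : Tendsto (fun t : ℝ≥0 => ((t : ℝ) : ℂ)⁻¹ • (T t (x - p) - (x - p))) (𝓝[>] 0)
          (𝓝 (z - A p)) := by
        refine (h.sub (hderiv p)).congr fun t => ?_
        rw [← smul_sub, map_sub]
        congr 1
        abel
      have h2 : (⟪z - A p, x - p⟫_ℂ).re ≤ 0 := by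
        refine le_of_tendsto ((Complex.continuous_re.tendsto _).comp (h1.inner tendsto_const_nhds))
          (Eventually.of_forall fun t => ?_)
        simp only [Function.comp]
        rw [inner_smul_left, ← Complex.ofReal_inv, Complex.conj_ofReal, Complex.re_ofReal_mul]
        refine mul_nonpos_of_nonneg_of_nonpos (by positivity) ?_
        rw [inner_sub_left, Complex.sub_re, re_inner_self_eq_norm_sq]
        have h3 : (⟪T t (x - p), x - p⟫_ℂ).re ≤ ‖T t (x - p)‖ * ‖x - p‖ :=
          (Complex.re_le_norm _).trans (norm_inner_le_norm _ _)
        nlinarith [hnorm t (x - p), norm_nonneg (x - (p : X))]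
      have h3 : z - A p = x - p := by
        rw [show A p = p - (x - z) by rw [← hp]; abel]
        abel
      rw [h3, re_inner_self_eq_norm_sq] at h2
      have h4 : x - p = 0 := by
        simpa using le_antisymm h2 (sq_nonneg _)
      rw [h4] at h3
      rw [sub_eq_zero.1 h4, sub_eq_zero.1 h3]
      exact A.mem_graph p

end IsMaximalDissipative

/-! ### The extrapolation space and rigged extensions -/

section Extrapolation

variable {X : Type*} [NormedAddCommGroup X] [InnerProductSpace ℂ X]
  {A : X →ₗ.[ℂ] X} {β : ℂ} (hβ : β ∈ resolventPoints A)

namespace IsMaximalDissipative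

variable (hA : IsMaximalDissipative A) [CompleteSpace X]
include hA

/-- The graph of `(β - A)⁻¹` is closed because it can be expressed by the bounded resolvent at `1`. -/
theorem continuous_resolventMap : Continuous fun x => (resolventMap A hβ x : X) := by
  have h1 : (0 : ℝ) < (1 : ℂ).re := by simp
  refine (A.domain.subtype ∘ₗ (resolventMap A hβ).toLinearMap).continuous_of_isClosed_graph ?_
  have : ((A.domain.subtype ∘ₗ (resolventMap A hβ).toLinearMap).graph : Set (X × X)) =
      {p | p.2 = hA.resolvent h1 (p.1 + (1 - β) • p.2)} := by
    ext p
    simp only [SetLike.mem_coe, LinearMap.mem_graph_iff, Set.mem_ofPred_eq, resolvent_apply]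
    constructor
    · intro h
      have h2 : p.2 = resolventMap A hβ p.1 := h
      have h3 := smul_resolventMap_sub A hβ p.1
      rw [h2]
      refine congrArg Subtype.val (resolventMap_apply_eq A _ (resolventMap A hβ p.1) ?_).symm
      rw [← sub_eq_zero] at h3 ⊢
      rw [← h3, sub_smul]
      abel
    · intro h
      set x := resolventMap A (hA.mem_resolventPoints h1) (p.1 + (1 - β) • p.2) with hx
      have h3 := smul_resolventMap_sub A (hA.mem_resolventPoints h1) (p.1 + (1 - β) • p.2)
      rw [← hx] at h3
      have h4 : resolventMap A hβ p.1 = x := by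
        refine resolventMap_apply_eq A _ _ ?_
        rw [h] at h3
        rw [← sub_eq_zero] at h3 ⊢
        rw [← h3, sub_smul]
        abel
      rw [h]
      exact congrArg Subtype.val h4.symm
  rw [this]
  exact isClosed_eq (by fun_prop) (by fun_prop)

/-- The unitary extension `X₋₁ → X` of `(β - A)⁻¹`. -/
def extrapolationEquiv : Extrapolation A hβ ≃ₗᵢ[ℂ] X :=
  ((toPreExtrapolation A hβ).symm.trans (resolventMap A hβ)).extendOfIsometry
    (UniformSpace.Completion.toComplₗᵢ (𝕜 := ℂ) (E := PreExtrapolation A hβ)).toLinearMap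
    A.domain.subtype UniformSpace.Completion.denseRange_coe
    (by simpa [DenseRange] using hA.dense_domain)
    (fun x => (UniformSpace.Completion.norm_coe x).symm)

theorem extrapolationEquiv_incl (x : X) :
    hA.extrapolationEquiv hβ (extrapolationIncl A hβ x) = resolventMap A hβ x :=
  LinearEquiv.extendOfIsometry_eq _ _ _ _ _ _ _

/-- The inclusion of `X` into `X₋₁` as a bounded operator. -/
def extrapolationInclCLM : X →L[ℂ] Extrapolation A hβ :=
  ⟨extrapolationIncl A hβ, by
    have h : (extrapolationIncl A hβ : X → Extrapolation A hβ) = fun x =>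
        (hA.extrapolationEquiv hβ).symm (resolventMap A hβ x) := by
      ext x
      rw [← hA.extrapolationEquiv_incl hβ, LinearIsometryEquiv.symm_apply_apply]
    change Continuous (extrapolationIncl A hβ : X → Extrapolation A hβ)
    rw [h]
    exact (hA.extrapolationEquiv hβ).symm.continuous.comp (hA.continuous_resolventMap hβ)⟩

theorem extrapolationIncl_injective : Function.Injective (extrapolationIncl A hβ) := by
  intro x y h
  have h2 := congrArg (hA.extrapolationEquiv hβ) h
  rw [extrapolationEquiv_incl, extrapolationEquiv_incl] at h2
  exact (resolventMap A hβ).injective (Subtype.ext h2)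

/-- The bounded extension `A|_X : X → X₋₁` of `A`, defined by the property that `β - A|_X` is the
inverse of the unitary extension of `(β - A)⁻¹`. -/
def extrapolationExtension : X →L[ℂ] Extrapolation A hβ :=
  β • hA.extrapolationInclCLM hβ -
    ((hA.extrapolationEquiv hβ).symm.toContinuousLinearEquiv : X →L[ℂ] Extrapolation A hβ)

theorem extrapolationExtension_apply (x : X) : hA.extrapolationExtension hβ x =
    β • extrapolationIncl A hβ x - (hA.extrapolationEquiv hβ).symm x := rfl

theorem extrapolationExtension_coe (x : A.domain) :
    hA.extrapolationExtension hβ x = extrapolationIncl A hβ (A x) := by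
  have h : (hA.extrapolationEquiv hβ).symm (x : X) =
      extrapolationIncl A hβ (β • (x : X) - A x) := by
    rw [LinearIsometryEquiv.symm_apply_eq, extrapolationEquiv_incl,
      resolventMap_apply_eq A hβ x rfl]
  rw [extrapolationExtension_apply, h, map_sub, map_smul, sub_sub_cancel]

theorem mem_domain_of_extrapolationExtension_mem {x w : X}
    (h : hA.extrapolationExtension hβ x = extrapolationIncl A hβ w) : x ∈ A.domain := by
  rw [extrapolationExtension_apply, sub_eq_iff_eq_add, ← sub_eq_iff_eq_add', ← map_smul,
    ← map_sub] at h
  have h2 := congrArg (hA.extrapolationEquiv hβ) h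
  rw [extrapolationEquiv_incl, LinearIsometryEquiv.apply_symm_apply] at h2
  rw [← h2]
  exact Subtype.coe_prop _

theorem bijective_subExtension {μ : ℂ} (hμ : μ ∈ resolventPoints A) :
    Function.Bijective (subExtension (hA.extrapolationExtension hβ) μ) := by
  have happ : ∀ x, subExtension (hA.extrapolationExtension hβ) μ x =
      μ • extrapolationIncl A hβ x - hA.extrapolationExtension hβ x := fun _ => rfl
  constructor
  · refine (injective_iff_map_eq_zero _).2 fun x hx => ?_
    rw [happ, sub_eq_zero, ← map_smul] at hx
    have hmem := hA.mem_domain_of_extrapolationExtension_mem hβ hx.symm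
    rw [show x = ((⟨x, hmem⟩ : A.domain) : X) from rfl, extrapolationExtension_coe] at hx
    have h2 := hA.extrapolationIncl_injective hβ hx
    have h3 := resolventMap_apply_eq A hμ ⟨x, hmem⟩ (sub_eq_zero.2 h2)
    rw [map_zero] at h3
    exact (congrArg Subtype.val h3).symm
  · intro y
    -- `(β - A|_X) x = y`, corrected by an element of the domain of `A`
    set x := hA.extrapolationEquiv hβ y with hx
    set p := resolventMap A hμ x with hp
    refine ⟨x + (β - μ) • (p : X), ?_⟩
    have h1 : (hA.extrapolationEquiv hβ).symm x = y := LinearIsometryEquiv.symm_apply_apply _ _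
    have h2 : subExtension (hA.extrapolationExtension hβ) μ (p : X) = extrapolationIncl A hβ x := by
      rw [happ, extrapolationExtension_coe, ← map_smul, ← map_sub, smul_resolventMap_sub]
    rw [map_add, map_smul, h2, happ, extrapolationExtension_apply, h1, sub_smul]
    abel

end IsMaximalDissipative

end Extrapolation

section RiggedExtension

variable {X U Y : Type*} [NormedAddCommGroup X] [InnerProductSpace ℂ X]
  [NormedAddCommGroup U] [InnerProductSpace ℂ U] [NormedAddCommGroup Y] [InnerProductSpace ℂ Y]
  {S : X × U →ₗ.[ℂ] X × Y}
  {E : U →L[ℂ] X} {ν : ℂ} (hE : ∀ u, ∃ y, ((E u, u), (ν • E u, y)) ∈ S.graph)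

include hE in
theorem IsRiggedExtension.subExtension_apply {β : ℂ}
    {hβ : β ∈ resolventPoints (mainOperator S)}
    {A' : X →L[ℂ] Extrapolation (mainOperator S) hβ}
    {B : U →L[ℂ] Extrapolation (mainOperator S) hβ} (h : IsRiggedExtension S hβ A' B) (u : U) :
    subExtension A' ν (E u) = B u := by
  obtain ⟨y, hy⟩ := hE u
  obtain ⟨q, hq, hq2⟩ := (LinearPMap.mem_graph_iff S).1 hy
  have h1 := h.extends_op q
  rw [hq, hq2] at h1
  change ν • extrapolationIncl (mainOperator S) hβ (E u) - A' (E u) = _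
  rw [← map_smul, ← h1]
  simp

variable [CompleteSpace X] (hA : IsMaximalDissipative (mainOperator S))
include hA

/-- The two bounded operators agree on the domain of the main operator, which is dense. -/
theorem IsRiggedExtension.eq_extrapolationExtension {β : ℂ}
    {hβ : β ∈ resolventPoints (mainOperator S)}
    {A' : X →L[ℂ] Extrapolation (mainOperator S) hβ}
    {B : U →L[ℂ] Extrapolation (mainOperator S) hβ} (h : IsRiggedExtension S hβ A' B) :
    A' = hA.extrapolationExtension hβ := by
  refine ContinuousLinearMap.coeFn_injective
    (Continuous.ext_on hA.dense_domain A'.continuous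
      (hA.extrapolationExtension hβ).continuous fun x hx => ?_)
  rw [show x = ((⟨x, hx⟩ : (mainOperator S).domain) : X) from rfl,
    hA.extrapolationExtension_coe hβ]
  have := h.extends_op ⟨(x, 0), hx⟩
  rwa [map_zero, add_zero] at this

include hE

/-- The pairs `(E u, u)` give a right inverse of `(x, u) ↦ u` on the domain of `S`, so the domain is
determined by that of the main operator, and the control operator is forced to be `(ν - A|_X) E`. -/
theorem exists_isRiggedExtension {β : ℂ} (hβ : β ∈ resolventPoints (mainOperator S)) :
    ∃ A' B, IsRiggedExtension S hβ A' B := by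
  refine ⟨hA.extrapolationExtension hβ,
    (ν • hA.extrapolationInclCLM hβ - hA.extrapolationExtension hβ) ∘L E, ?_⟩
  have happ : ∀ p : X × U, hA.extrapolationExtension hβ p.1 +
      ((ν • hA.extrapolationInclCLM hβ - hA.extrapolationExtension hβ) ∘L E) p.2 =
      hA.extrapolationExtension hβ (p.1 - E p.2) +
        extrapolationIncl (mainOperator S) hβ (ν • E p.2) := by
    intro p
    rw [map_sub, map_smul]
    change _ + (ν • extrapolationIncl (mainOperator S) hβ (E p.2) - _) = _
    abel
  have hsub : ∀ p : S.domain, ∃ h : (p : X × U).1 - E (p : X × U).2 ∈ (mainOperator S).domain,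
      mainOperator S ⟨_, h⟩ = (S p).1 - ν • E (p : X × U).2 := by
    intro p
    obtain ⟨y, hy⟩ := hE (p : X × U).2
    have h1 := S.graph.sub_mem (S.mem_graph p) hy
    obtain ⟨q, hq, hq2⟩ := (LinearPMap.mem_graph_iff S).1 h1
    have hq' : (q : X × U) = ((p : X × U).1 - E (p : X × U).2, 0) := by
      rw [hq]
      exact Prod.ext rfl (sub_self _)
    have hmem : (p : X × U).1 - E (p : X × U).2 ∈ (mainOperator S).domain := by
      change ((p : X × U).1 - E (p : X × U).2, (0 : U)) ∈ S.domain
      rw [← hq']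
      exact q.2
    refine ⟨hmem, ?_⟩
    have : mainOperator S ⟨_, hmem⟩ = (S q).1 := by
      change (S ⟨((p : X × U).1 - E (p : X × U).2, (0 : U)), hmem⟩).1 = _
      congr 3
      exact hq'.symm
    rw [this, hq2]
    rfl
  refine ⟨fun p => ?_, fun p => ⟨fun h => ?_, ?_⟩⟩
  · obtain ⟨h, h2⟩ := hsub p
    rw [happ, show (p : X × U).1 - E (p : X × U).2 =
      ((⟨_, h⟩ : (mainOperator S).domain) : X) from rfl, hA.extrapolationExtension_coe hβ, h2,
      ← map_add, sub_add_cancel]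
  · obtain ⟨h, h2⟩ := hsub ⟨p, h⟩
    rw [happ, show p.1 - E p.2 =
      ((⟨_, h⟩ : (mainOperator S).domain) : X) from rfl, hA.extrapolationExtension_coe hβ, ← map_add]
    exact ⟨_, rfl⟩
  · rintro ⟨w, hw⟩
    rw [happ, ← sub_eq_iff_eq_add, ← map_sub] at hw
    have hmem := hA.mem_domain_of_extrapolationExtension_mem hβ hw.symm
    obtain ⟨y, hy⟩ := hE p.2
    have h1 : (p.1 - E p.2, (0 : U)) ∈ S.domain := hmem
    have h2 := S.domain.add_mem h1 (LinearPMap.mem_domain_of_mem_graph hy)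
    simpa using h2

end RiggedExtension

/-! ### Reproducing kernel Hilbert spaces -/

section ReproducingKernel

variable {V : Type*} [NormedAddCommGroup V] [InnerProductSpace ℂ V] [CompleteSpace V]

section Continuity

variable {X H : Type*} [NormedAddCommGroup H] [InnerProductSpace ℂ H] [CompleteSpace H]
  [RKHS ℂ H X V]

theorem inner_kerFun_kerFun (x y : X) (v w : V) :
    ⟪RKHS.kerFun H x v, RKHS.kerFun H y w⟫_ℂ = ⟪v, RKHS.kernel H x y w⟫_ℂ := by
  rw [RKHS.kerFun_inner, RKHS.kerFun_apply]

variable [TopologicalSpace X]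

theorem continuous_kerFun_apply {v : V}
    (hK : Continuous fun p : X × X => ⟪v, RKHS.kernel H p.1 p.2 v⟫_ℂ) :
    Continuous fun x => RKHS.kerFun H x v := by
  rw [continuous_iff_continuousAt]
  intro y
  obtain ⟨k, hk⟩ : ∃ k : X × X → ℂ, ∀ p, k p = ⟪v, RKHS.kernel H p.1 p.2 v⟫_ℂ := ⟨_, fun _ => rfl⟩
  simp only [← hk] at hK
  have h1 : ∀ x, ‖RKHS.kerFun H x v - RKHS.kerFun H y v‖ ^ 2 =
      (k (x, x) - k (y, x) - (k (x, y) - k (y, y))).re := by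
    intro x
    rw [← re_inner_self_eq_norm_sq]
    simp only [hk, inner_sub_left, inner_sub_right, inner_kerFun_kerFun]
  have h2 : Continuous fun x => ‖RKHS.kerFun H x v - RKHS.kerFun H y v‖ ^ 2 := by
    simp only [h1]
    fun_prop
  have h3 := (h2.sqrt).tendsto y
  simp only [Real.sqrt_sq (norm_nonneg _), sub_self, norm_zero, Real.sqrt_sq le_rfl] at h3
  exact tendsto_iff_norm_sub_tendsto_zero.2 h3

theorem continuous_apply_inner {v : V}
    (hK : Continuous fun p : X × X => ⟪v, RKHS.kernel H p.1 p.2 v⟫_ℂ) (f : H) :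
    Continuous fun x => ⟪f x, v⟫_ℂ := by
  simp only [← RKHS.inner_kerFun]
  exact continuous_const.inner (continuous_kerFun_apply hK)

end Continuity

section WeightedComposition

variable {X₁ X₂ H₁ H₂ : Type*}
  [NormedAddCommGroup H₁] [InnerProductSpace ℂ H₁] [CompleteSpace H₁] [RKHS ℂ H₁ X₁ V]
  [NormedAddCommGroup H₂] [InnerProductSpace ℂ H₂] [CompleteSpace H₂] [RKHS ℂ H₂ X₂ V]

/-- The linear map from finitely supported families of vectors that sends the vector `v` at `x` to
the kernel function `conj (c x) k_{σ x} v`. -/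
def weightedKernelSum (H₁ : Type*) [NormedAddCommGroup H₁] [InnerProductSpace ℂ H₁]
    [CompleteSpace H₁] [RKHS ℂ H₁ X₁ V] (σ : X₂ → X₁) (c : X₂ → ℂ) : (X₂ →₀ V) →ₗ[ℂ] H₁ :=
  Finsupp.lsum ℂ fun x => (conj (c x) • RKHS.kerFun H₁ (σ x)).toLinearMap

theorem weightedKernelSum_single (σ : X₂ → X₁) (c : X₂ → ℂ) (x : X₂) (v : V) :
    weightedKernelSum H₁ σ c (Finsupp.single x v) = conj (c x) • RKHS.kerFun H₁ (σ x) v := by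
  simp [weightedKernelSum]

theorem denseRange_weightedKernelSum {σ : X₂ → X₁} (hσ : Function.Surjective σ) {c : X₂ → ℂ}
    (hc : ∀ x, c x ≠ 0) : DenseRange (weightedKernelSum H₁ σ c) := by
  rw [DenseRange, ← LinearMap.coe_range, Submodule.dense_iff_topologicalClosure_eq_top, eq_top_iff,
    ← RKHS.kerFun_dense H₁]
  refine Submodule.topologicalClosure_mono (Submodule.span_le.2 ?_)
  rintro _ ⟨x, v, rfl⟩
  obtain ⟨y, rfl⟩ := hσ x
  refine ⟨Finsupp.single y ((conj (c y))⁻¹ • v), ?_⟩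
  rw [weightedKernelSum_single, map_smul, smul_inv_smul₀]
  exact (map_ne_zero _).2 (hc y)

theorem norm_weightedKernelSum {σ : X₂ → X₁} {c : X₂ → ℂ}
    (hK : ∀ x y, RKHS.kernel H₂ x y = (c x * conj (c y)) • RKHS.kernel H₁ (σ x) (σ y))
    (a : X₂ →₀ V) : ‖weightedKernelSum H₂ id 1 a‖ = ‖weightedKernelSum H₁ σ c a‖ := by
  have h : ⟪weightedKernelSum H₂ id 1 a, weightedKernelSum H₂ id 1 a⟫_ℂ =
      ⟪weightedKernelSum H₁ σ c a, weightedKernelSum H₁ σ c a⟫_ℂ := by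
    simp only [weightedKernelSum, Finsupp.lsum_apply, Finsupp.sum, sum_inner, inner_sum]
    refine Finset.sum_congr rfl fun x _ => Finset.sum_congr rfl fun y _ => ?_
    simp [-RKHS.inner_kerFun, -RKHS.kerFun_inner, inner_kerFun_kerFun, inner_smul_left,
      inner_smul_right, hK, mul_assoc, mul_comm, mul_left_comm]
  rw [← sq_eq_sq₀ (norm_nonneg _) (norm_nonneg _), ← re_inner_self_eq_norm_sq, h,
    re_inner_self_eq_norm_sq]

/-- If `K₂(x, y) = c(x) conj (c(y)) K₁(σ x, σ y)` with `σ` onto and `c` zero-free, then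
`f ↦ c · (f ∘ σ)` is unitary between the reproducing kernel Hilbert spaces: it maps
`conj (c x) k_{σ x} v` to `k_x v`. -/
theorem exists_weightedComposition {σ : X₂ → X₁} (hσ : Function.Surjective σ) {c : X₂ → ℂ}
    (hc : ∀ x, c x ≠ 0)
    (hK : ∀ x y, RKHS.kernel H₂ x y = (c x * conj (c y)) • RKHS.kernel H₁ (σ x) (σ y)) :
    ∃ Ξ : H₁ ≃ₗᵢ[ℂ] H₂, (∀ (f : H₁) (x : X₂), Ξ f x = c x • f (σ x)) ∧
      ∀ x v, Ξ (conj (c x) • RKHS.kerFun H₁ (σ x) v) = RKHS.kerFun H₂ x v := by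
  let Ξ : H₁ ≃ₗᵢ[ℂ] H₂ := (LinearEquiv.refl ℂ (X₂ →₀ V)).extendOfIsometry
    (weightedKernelSum H₁ σ c) (weightedKernelSum H₂ id 1) (denseRange_weightedKernelSum hσ hc)
    (denseRange_weightedKernelSum Function.surjective_id (by simp))
    (fun a => norm_weightedKernelSum hK a)
  have hΞ : ∀ x v, Ξ (conj (c x) • RKHS.kerFun H₁ (σ x) v) = RKHS.kerFun H₂ x v := by
    intro x v
    rw [← weightedKernelSum_single]
    refine (LinearEquiv.extendOfIsometry_eq _ _ _ _ _ _ _).trans ?_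
    simp [weightedKernelSum_single]
  refine ⟨Ξ, fun f x => ext_inner_right ℂ fun v => ?_, hΞ⟩
  rw [← RKHS.inner_kerFun, ← hΞ, LinearIsometryEquiv.inner_map_map, inner_smul_right,
    inner_smul_left, RKHS.inner_kerFun]

end WeightedComposition

end ReproducingKernel

/-! ### Kernels on the half-plane and on the disk -/

section Kernels

variable {U Y : Type*} [NormedAddCommGroup U] [InnerProductSpace ℂ U] [CompleteSpace U]
  [NormedAddCommGroup Y] [InnerProductSpace ℂ Y] [CompleteSpace Y]

theorem RightHalfPlane.add_ne_zero (μ l : RightHalfPlane) : (μ : ℂ) + l ≠ 0 := fun h => by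
  have := congrArg Complex.re h
  have := μ.2
  have := l.2
  simp at *
  linarith

theorem RightHalfPlane.coe_conj (μ : RightHalfPlane) : (μ.conj : ℂ) = conj (μ : ℂ) := rfl

theorem RightHalfPlane.conj_conj (μ : RightHalfPlane) : μ.conj.conj = μ :=
  Subtype.ext (Complex.conj_conj _)

theorem kernelHalfPlane_apply (φ : SchurHalfPlane U Y) (μ l : RightHalfPlane) (u : U) :
    kernelHalfPlane φ μ l u = ((μ : ℂ) + conj (l : ℂ))⁻¹ •
      (u - (φ (conj (μ : ℂ))).adjoint (φ (conj (l : ℂ)) u)) := rfl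

theorem kernelDisk_apply (ψ : SchurDisk U Y) (z w : Disk) (u : U) :
    kernelDisk ψ z w u = (1 - (z : ℂ) * conj (w : ℂ))⁻¹ •
      (u - (ψ (conj (z : ℂ))).adjoint (ψ (conj (w : ℂ)) u)) := rfl

theorem continuous_inner_kernelHalfPlane (φ : SchurHalfPlane U Y) (u : U) :
    Continuous fun p : RightHalfPlane × RightHalfPlane => ⟪u, kernelHalfPlane φ p.1 p.2 u⟫_ℂ := by
  simp only [kernelHalfPlane_apply, inner_smul_right, inner_sub_right,
    ContinuousLinearMap.adjoint_inner_right]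
  have h1 : Continuous fun μ : RightHalfPlane => φ (conj (μ : ℂ)) :=
    φ.differentiableOn.continuousOn.comp_continuous
      (Complex.continuous_conj.comp continuous_subtype_val) fun μ => μ.conj.2
  refine Continuous.mul (Continuous.inv₀ ?_ fun p => p.1.add_ne_zero p.2.conj) ?_
  · exact (continuous_subtype_val.comp continuous_fst).add
      (Complex.continuous_conj.comp (continuous_subtype_val.comp continuous_snd))
  · exact continuous_const.sub (((h1.comp continuous_fst).clm_apply continuous_const).inner
      ((h1.comp continuous_snd).clm_apply continuous_const))

theorem one_sub_mul_conj_ne_zero (z w : Disk) : 1 - (z : ℂ) * conj (w : ℂ) ≠ 0 := by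
  intro h0
  have h1 : ‖(z : ℂ) * conj (w : ℂ)‖ = 1 := by rw [← sub_eq_zero.mp h0]; simp
  rw [norm_mul, RCLike.norm_conj] at h1
  nlinarith [z.2, w.2, norm_nonneg (z : ℂ), norm_nonneg (w : ℂ)]

theorem continuous_inner_kernelDisk (ψ : SchurDisk U Y) (u : U) :
    Continuous fun p : Disk × Disk => ⟪u, kernelDisk ψ p.1 p.2 u⟫_ℂ := by
  simp only [kernelDisk_apply, inner_smul_right, inner_sub_right,
    ContinuousLinearMap.adjoint_inner_right]
  have h1 : Continuous fun z : Disk => ψ (conj (z : ℂ)) :=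
    ψ.differentiableOn.continuousOn.comp_continuous
      (Complex.continuous_conj.comp continuous_subtype_val) fun z => by
        simpa using z.2
  refine Continuous.mul (Continuous.inv₀ ?_ fun p => one_sub_mul_conj_ne_zero p.1 p.2) ?_
  · exact continuous_const.sub ((continuous_subtype_val.comp continuous_fst).mul
      (Complex.continuous_conj.comp (continuous_subtype_val.comp continuous_snd)))
  · exact continuous_const.sub (((h1.comp continuous_fst).clm_apply continuous_const).inner
      ((h1.comp continuous_snd).clm_apply continuous_const))

theorem continuous_inner_apply_halfPlane (φ : SchurHalfPlane U Y) (x : HcHalfPlane φ) (u : U) :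
    Continuous fun μ => ⟪x μ, u⟫_ℂ :=
  continuous_apply_inner (by
    simpa only [RKHS.OfKernel.kernel_ofKernel] using continuous_inner_kernelHalfPlane φ u) x

theorem continuous_inner_apply_disk (ψ : SchurDisk U Y) (f : HcDisk ψ) (u : U) :
    Continuous fun z => ⟪f z, u⟫_ℂ :=
  continuous_apply_inner (by
    simpa only [RKHS.OfKernel.kernel_ofKernel] using continuous_inner_kernelDisk ψ u) f

theorem cayleyToHalfPlane_conj_cayleyToDisk (α μ : RightHalfPlane) :
    cayleyToHalfPlane α (conj (cayleyToDisk α.conj μ : ℂ)) = conj (μ : ℂ) := by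
  have h1 := α.conj.add_ne_zero μ.conj
  have h2 := α.add_ne_zero α.conj
  simp only [RightHalfPlane.coe_conj] at h1 h2
  simp only [cayleyToHalfPlane, cayleyToDisk, RightHalfPlane.coe_conj, map_div₀, map_sub, map_add,
    Complex.conj_conj]
  field_simp
  rw [div_eq_iff]
  · ring
  · convert h2 using 1
    ring

theorem cayleyToDisk_surjective (α : RightHalfPlane) : Function.Surjective (cayleyToDisk α) := by
  intro z
  have h0 := one_add_ne_zero_of_norm_lt z.2
  refine ⟨⟨cayleyToHalfPlane α z, cayleyToHalfPlane_re_pos α z.2⟩, Subtype.ext ?_⟩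
  have h2 := α.add_ne_zero α.conj
  simp only [RightHalfPlane.coe_conj] at h2
  simp only [cayleyToHalfPlane, cayleyToDisk]
  rw [div_eq_iff]
  · field_simp
    ring
  · exact α.conj.add_ne_zero ⟨cayleyToHalfPlane α z, cayleyToHalfPlane_re_pos α z.2⟩

/-- The weight `√(2 re α) / (α + μ)` of the unitary operator `Ξ`. -/
def weight (α μ : RightHalfPlane) : ℂ := (√(2 * (α : ℂ).re) : ℂ) / (α + μ)

theorem sqrt_ne_zero (α : RightHalfPlane) : (√(2 * (α : ℂ).re) : ℂ) ≠ 0 := by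
  have := α.2
  have h : √(2 * (α : ℂ).re) ≠ 0 := (Real.sqrt_pos.2 (by positivity)).ne'
  exact_mod_cast h

theorem sqrt_mul_sqrt (α : RightHalfPlane) :
    (√(2 * (α : ℂ).re) : ℂ) * √(2 * (α : ℂ).re) = α + conj (α : ℂ) := by
  have := α.2
  rw [← Complex.ofReal_mul, Real.mul_self_sqrt (by positivity), Complex.add_conj]

theorem weight_ne_zero (α μ : RightHalfPlane) : weight α μ ≠ 0 :=
  div_ne_zero (sqrt_ne_zero α) (α.add_ne_zero μ)

theorem xi_conj_apply {V : Type*} [NormedAddCommGroup V] [NormedSpace ℂ V] (α : RightHalfPlane)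
    (ξ : Disk → V) (μ : RightHalfPlane) :
    xi α.conj ξ μ = weight α μ • ξ (cayleyToDisk α.conj μ) := by
  simp [xi, weight, RightHalfPlane.coe_conj]

theorem kernelHalfPlane_eq_weight (φ : SchurHalfPlane U Y) (α μ l : RightHalfPlane) :
    kernelHalfPlane φ μ l = (weight α μ * conj (weight α l)) •
      kernelDisk (φ.toDisk α) (cayleyToDisk α.conj μ) (cayleyToDisk α.conj l) := by
  have hμ := α.add_ne_zero μ
  have hl := α.conj.add_ne_zero l.conj
  have hμl := μ.add_ne_zero l.conj
  have hα := α.add_ne_zero α.conj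
  simp only [RightHalfPlane.coe_conj] at hl hμl hα
  simp only [kernelHalfPlane, kernelDisk, SchurHalfPlane.toDisk, Matrix.of_apply,
    cayleyToHalfPlane_conj_cayleyToDisk, smul_smul]
  congr 1
  have h7 : (1 : ℂ) - (cayleyToDisk α.conj μ : ℂ) * conj (cayleyToDisk α.conj l : ℂ) =
      (α + conj (α : ℂ)) * (μ + conj (l : ℂ)) / ((α + μ) * (conj (α : ℂ) + conj (l : ℂ))) := by
    simp only [cayleyToDisk, RightHalfPlane.coe_conj, map_div₀, map_sub, map_add,
      Complex.conj_conj]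
    field_simp
    ring
  have h8 : weight α μ * conj (weight α l) =
      (α + conj (α : ℂ)) / ((α + μ) * (conj (α : ℂ) + conj (l : ℂ))) := by
    rw [weight, weight, map_div₀, Complex.conj_ofReal, div_mul_div_comm, sqrt_mul_sqrt, map_add]
  rw [h7, h8]
  field_simp

theorem exists_xi (φ : SchurHalfPlane U Y) (α : RightHalfPlane) :
    ∃ Ξ : HcDisk (φ.toDisk α) ≃ₗᵢ[ℂ] HcHalfPlane φ,
      (∀ (ξ : HcDisk (φ.toDisk α)) (μ : RightHalfPlane),
        Ξ ξ μ = weight α μ • ξ (cayleyToDisk α.conj μ)) ∧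
      ∀ μ u, Ξ (conj (weight α μ) • RKHS.kerFun (HcDisk (φ.toDisk α)) (cayleyToDisk α.conj μ) u) =
        evalAdjoint φ μ u :=
  exists_weightedComposition (cayleyToDisk_surjective α.conj) (weight_ne_zero α) fun μ l => by
    rw [RKHS.OfKernel.kernel_ofKernel, RKHS.OfKernel.kernel_ofKernel]
    exact kernelHalfPlane_eq_weight φ α μ l

end Kernels

/-! ### The controllable model as a maximal dissipative system node -/

section MainOperator

variable {X U Y : Type*} [NormedAddCommGroup X] [InnerProductSpace ℂ X]
  [NormedAddCommGroup U] [InnerProductSpace ℂ U] [NormedAddCommGroup Y] [InnerProductSpace ℂ Y]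
  (S : X × U →ₗ.[ℂ] X × Y)

theorem mainOperator_mem_graph (x : (mainOperator S).domain) :
    (((x : X), (0 : U)), (mainOperator S x, observation S x)) ∈ S.graph :=
  S.mem_graph ⟨((x : X), (0 : U)), x.2⟩

theorem exists_mainOperator_eq {x z : X} {y : Y} (h : ((x, (0 : U)), (z, y)) ∈ S.graph) :
    ∃ p : (mainOperator S).domain, (p : X) = x ∧ mainOperator S p = z ∧ observation S p = y := by
  obtain ⟨q, hq, hq2⟩ := (LinearPMap.mem_graph_iff S).1 h
  obtain ⟨q, hmem⟩ := q
  change q = _ at hq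
  subst hq
  exact ⟨⟨x, hmem⟩, rfl, congrArg Prod.fst hq2, congrArg Prod.snd hq2⟩

end MainOperator

section Model

variable {U Y : Type*} [NormedAddCommGroup U] [InnerProductSpace ℂ U] [CompleteSpace U]
  [NormedAddCommGroup Y] [InnerProductSpace ℂ Y] [CompleteSpace Y] (φ : SchurHalfPlane U Y)

theorem generator_mem_graph (l : RightHalfPlane) (u : U) :
    ((evalAdjoint φ l.conj u, u), ((l : ℂ) • evalAdjoint φ l.conj u, φ l u)) ∈
      (controllableNode φ).graph := by
  rw [controllableNode_graph]
  exact (preGraph φ).le_topologicalClosure (Submodule.subset_span ⟨(l, u), rfl⟩)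

/-- The difference of two generators with the same input has input zero. -/
theorem generator_sub_mem_graph (l μ : RightHalfPlane) (u : U) :
    ((evalAdjoint φ l.conj u - evalAdjoint φ μ.conj u, (0 : U)),
      ((l : ℂ) • evalAdjoint φ l.conj u - (μ : ℂ) • evalAdjoint φ μ.conj u, φ l u - φ μ u)) ∈
      (controllableNode φ).graph := by
  have h := (controllableNode φ).graph.sub_mem (generator_mem_graph φ l u)
    (generator_mem_graph φ μ u)
  rwa [Prod.mk_sub_mk, Prod.mk_sub_mk, Prod.mk_sub_mk, sub_self] at h

variable {φ}

/-- The power balance of the model, in terms of the variables of its Cayley transform. -/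
theorem norm_sq_add_norm_sq_of_mem_graph {x z : HcHalfPlane φ} {u : U} {y : Y}
    (h : ((x, u), (z, y)) ∈ (controllableNode φ).graph) (α : ℂ) :
    ‖α • x - z‖ ^ 2 + 2 * α.re * ‖u‖ ^ 2 = ‖conj α • x + z‖ ^ 2 + 2 * α.re * ‖y‖ ^ 2 := by
  rw [controllableNode_graph] at h
  have h1 := congrArg Complex.re (powerForm_closure φ h h)
  simp only [powerForm_apply, Complex.sub_re, re_inner_self_eq_norm_sq, Complex.zero_re] at h1
  have h2 : (⟪z, x⟫_ℂ).re = (⟪x, z⟫_ℂ).re := by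
    rw [← inner_conj_symm, Complex.conj_re]
  have h3 := norm_sub_sq (𝕜 := ℂ) (α • x) z
  have h4 := norm_add_sq (𝕜 := ℂ) (conj α • x) z
  simp only [inner_smul_left, RCLike.re_to_complex, Complex.mul_re, Complex.conj_re,
    Complex.conj_im, Complex.conj_conj, norm_smul, RCLike.norm_conj] at h3 h4
  rw [h3, h4]
  rw [h2] at h1
  linear_combination 2 * α.re * h1

/-- Obtained by pairing with the generator of the graph at `conj μ`. -/
theorem apply_of_mem_graph {x z : HcHalfPlane φ} {u : U} {y : Y}
    (h : ((x, u), (z, y)) ∈ (controllableNode φ).graph) (μ : RightHalfPlane) :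
    z μ = u - (φ (conj (μ : ℂ))).adjoint y - (μ : ℂ) • x μ := by
  refine ext_inner_right ℂ fun v => ?_
  have hg := generator_mem_graph φ μ.conj v
  rw [controllableNode_graph] at h hg
  have h1 := powerForm_closure φ h hg
  simp only [powerForm_apply, RightHalfPlane.conj_conj, evalAdjoint, RKHS.inner_kerFun,
    inner_smul_right, RightHalfPlane.coe_conj] at h1
  simp only [inner_sub_left, inner_smul_left, ContinuousLinearMap.adjoint_inner_left]
  linear_combination -h1

theorem re_inner_mainOperator_nonpos (x : (mainOperator (controllableNode φ)).domain) :
    (⟪mainOperator (controllableNode φ) x, (x : HcHalfPlane φ)⟫_ℂ).re ≤ 0 := by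
  have h := mainOperator_mem_graph (controllableNode φ) x
  rw [controllableNode_graph] at h
  have h1 := congrArg Complex.re (powerForm_closure φ h h)
  simp only [powerForm_apply, Complex.sub_re, re_inner_self_eq_norm_sq, Complex.zero_re,
    norm_zero] at h1
  have h2 : (⟪mainOperator (controllableNode φ) x, (x : HcHalfPlane φ)⟫_ℂ).re =
      (⟪(x : HcHalfPlane φ), mainOperator (controllableNode φ) x⟫_ℂ).re := by
    rw [← inner_conj_symm, Complex.conj_re]
  nlinarith [sq_nonneg ‖observation (controllableNode φ) x‖]

variable (φ)

/-- The part of the graph of the model with input zero. -/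
def zeroInputGraph : Submodule ℂ ((HcHalfPlane φ × U) × (HcHalfPlane φ × Y)) :=
  (controllableNode φ).graph ⊓
    (ContinuousLinearMap.snd ℂ (HcHalfPlane φ) U ∘L ContinuousLinearMap.fst ℂ _ _).ker

theorem isClosed_zeroInputGraph :
    IsClosed (zeroInputGraph φ : Set ((HcHalfPlane φ × U) × (HcHalfPlane φ × Y))) := by
  refine IsClosed.inter ?_ (ContinuousLinearMap.isClosed_ker _)
  rw [controllableNode_graph]
  exact Submodule.isClosed_topologicalClosure _

/-- The map `((x, 0), (z, y)) ↦ α x - z` on the zero input part of the graph. -/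
def resolventEquation (α : ℂ) : zeroInputGraph φ →L[ℂ] HcHalfPlane φ :=
  (α • (ContinuousLinearMap.fst ℂ _ _ ∘L ContinuousLinearMap.fst ℂ _ _) -
    ContinuousLinearMap.fst ℂ _ _ ∘L ContinuousLinearMap.snd ℂ _ _) ∘L (zeroInputGraph φ).subtypeL

theorem mem_range_resolventEquation {x z : HcHalfPlane φ} {y : Y}
    (h : ((x, (0 : U)), (z, y)) ∈ (controllableNode φ).graph) (α : ℂ) :
    α • x - z ∈ (resolventEquation φ α).range :=
  ⟨⟨_, h, rfl⟩, rfl⟩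

theorem isClosed_range_resolventEquation {α : ℂ} (hα : 0 < α.re) :
    IsClosed ((resolventEquation φ α).range : Set (HcHalfPlane φ)) := by
  have : CompleteSpace (zeroInputGraph φ) := (isClosed_zeroInputGraph φ).completeSpace_coe
  have hb : ∀ p, ‖p‖ ≤ (⟨α.re⁻¹ + (‖α‖ * α.re⁻¹ + 1) + (√(2 * α.re))⁻¹, by positivity⟩ : ℝ≥0) *
      ‖resolventEquation φ α p‖ := by
    rintro ⟨⟨⟨x, u⟩, ⟨z, y⟩⟩, hp, hu⟩
    change u = 0 at hu
    subst hu
    change ‖(((x, (0 : U)), (z, y)) : (HcHalfPlane φ × U) × (HcHalfPlane φ × Y))‖ ≤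
      (α.re⁻¹ + (‖α‖ * α.re⁻¹ + 1) + (√(2 * α.re))⁻¹) * ‖α • x - z‖
    obtain ⟨q, rfl, rfl, rfl⟩ := exists_mainOperator_eq _ hp
    set w := α • (q : HcHalfPlane φ) - mainOperator (controllableNode φ) q with hw
    have hx : ‖(q : HcHalfPlane φ)‖ ≤ α.re⁻¹ * ‖w‖ := by
      rw [inv_mul_eq_div, le_div_iff₀ hα, mul_comm]
      exact re_mul_norm_le (re_inner_mainOperator_nonpos q) α
    have hz : ‖mainOperator (controllableNode φ) q‖ ≤ (‖α‖ * α.re⁻¹ + 1) * ‖w‖ := by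
      have : mainOperator (controllableNode φ) q = α • (q : HcHalfPlane φ) - w := by
        rw [hw, sub_sub_cancel]
      rw [this]
      refine (norm_sub_le _ _).trans ?_
      rw [norm_smul, add_mul, one_mul, mul_assoc]
      gcongr
    have hy : ‖observation (controllableNode φ) q‖ ≤ (√(2 * α.re))⁻¹ * ‖w‖ := by
      have h2 := norm_sq_add_norm_sq_of_mem_graph hp α
      rw [← hw, norm_zero] at h2
      have hs : 0 < √(2 * α.re) := Real.sqrt_pos.2 (by positivity)
      rw [inv_mul_eq_div, le_div_iff₀ hs]
      refine le_of_sq_le_sq ?_ (norm_nonneg _)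
      rw [mul_pow, Real.sq_sqrt (by positivity)]
      nlinarith [sq_nonneg ‖conj α • (q : HcHalfPlane φ) + mainOperator (controllableNode φ) q‖]
    have e1 : 0 ≤ α.re⁻¹ * ‖w‖ := by positivity
    have e2 : 0 ≤ (‖α‖ * α.re⁻¹ + 1) * ‖w‖ := by positivity
    have e3 : 0 ≤ (√(2 * α.re))⁻¹ * ‖w‖ := by positivity
    simp only [Prod.norm_def, norm_zero, add_mul _ _ ‖w‖] at *
    refine max_le (max_le ?_ ?_) (max_le ?_ ?_) <;> linarith
  exact ((resolventEquation φ α).antilipschitz_of_bound hb).isClosed_range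
    (resolventEquation φ α).uniformContinuous

/-- Every point of the half-plane is a limit of other points. -/
theorem RightHalfPlane.exists_tendsto_ne (μ : RightHalfPlane) :
    ∃ s : ℕ → RightHalfPlane, (∀ n, s n ≠ μ) ∧ Tendsto s atTop (𝓝 μ) := by
  refine ⟨fun n => ⟨μ + ((1 / (n + 1) : ℝ) : ℂ), ?_⟩, fun n h => ?_, ?_⟩
  · rw [Complex.add_re, Complex.ofReal_re]
    have := μ.2
    positivity
  · have h2 := congrArg Subtype.val h
    have h3 : (1 / (n + 1) : ℝ) ≠ 0 := by positivity
    refine h3 ?_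
    have h4 : ((1 / (n + 1) : ℝ) : ℂ) = 0 := by simpa only [add_eq_left] using h2
    exact_mod_cast h4
  · refine tendsto_subtype_rng.2 ?_
    have h := (tendsto_one_div_add_atTop_nhds_zero_nat (𝕜 := ℝ)).ofReal.const_add (μ : ℂ)
    rwa [Complex.ofReal_zero, add_zero] at h

/-- An element orthogonal to the range of `α - A` vanishes off `conj α`, hence everywhere. -/
theorem range_resolventEquation (α : RightHalfPlane) : (resolventEquation φ α).range = ⊤ := by
  have hc := isClosed_range_resolventEquation φ α.2
  have hcomp : ((resolventEquation φ α).range).topologicalClosure = (resolventEquation φ α).range :=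
    hc.submodule_topologicalClosure_eq
  rw [← hcomp, Submodule.topologicalClosure_eq_top_iff, Submodule.eq_bot_iff]
  intro x hx
  have hne : ∀ μ : RightHalfPlane, μ ≠ α.conj → x μ = 0 := by
    intro μ hμ
    refine ext_inner_right ℂ fun u => ?_
    have h1 := Submodule.inner_left_of_mem_orthogonal
      (mem_range_resolventEquation φ (generator_sub_mem_graph φ μ.conj α u) α) hx
    have h2 : (α : ℂ) • (evalAdjoint φ μ.conj.conj u - evalAdjoint φ α.conj u) -
        ((μ.conj : ℂ) • evalAdjoint φ μ.conj.conj u - (α : ℂ) • evalAdjoint φ α.conj u) =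
        ((α : ℂ) - μ.conj) • evalAdjoint φ μ u := by
      rw [RightHalfPlane.conj_conj, smul_sub, sub_smul]
      abel
    rw [h2, inner_smul_right, evalAdjoint, RKHS.inner_kerFun] at h1
    rw [inner_zero_left]
    refine (mul_eq_zero.1 h1).resolve_left fun h0 => hμ ?_
    have : α = μ.conj := Subtype.ext (sub_eq_zero.1 h0)
    rw [this, RightHalfPlane.conj_conj]
  refine RKHS.ext fun μ => ?_
  rw [RKHS.coe_zero, Pi.zero_apply]
  by_cases hμ : μ = α.conj
  · refine ext_inner_right ℂ fun u => ?_
    obtain ⟨s, hs, hlim⟩ := μ.exists_tendsto_ne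
    refine tendsto_nhds_unique (((continuous_inner_apply_halfPlane φ x u).tendsto μ).comp hlim) ?_
    have : ∀ n, x (s n) = 0 := fun n => hne _ fun h => hs n (h.trans hμ.symm)
    simp [Function.comp_def, this]
  · exact hne μ hμ

theorem isMaximalDissipative_mainOperator :
    IsMaximalDissipative (mainOperator (controllableNode φ)) where
  re_inner_nonpos := re_inner_mainOperator_nonpos
  exists_eq μ hμ w := by
    have hw : w ∈ (resolventEquation φ μ).range := by
      rw [range_resolventEquation φ ⟨μ, hμ⟩]
      trivial
    obtain ⟨⟨⟨⟨x, u⟩, ⟨z, y⟩⟩, hp, hu⟩, rfl⟩ := hw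
    change u = 0 at hu
    subst hu
    obtain ⟨q, rfl, rfl, rfl⟩ := exists_mainOperator_eq _ hp
    exact ⟨q, rfl⟩

theorem isSystemNode_controllableNode : IsSystemNode (controllableNode φ) where
  isClosed := by
    rw [LinearPMap.IsClosed, controllableNode_graph]
    exact Submodule.isClosed_topologicalClosure _
  generator := (isMaximalDissipative_mainOperator φ).exists_isGenerator
  rigged _ hβ := exists_isRiggedExtension
    (E := evalAdjoint φ (RightHalfPlane.conj ⟨1, by simp⟩)) (ν := 1)
    (fun u => ⟨_, generator_mem_graph φ ⟨1, by simp⟩ u⟩) (isMaximalDissipative_mainOperator φ) hβ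

theorem mem_resolventPoints_controllableNode (α : RightHalfPlane) :
    (α : ℂ) ∈ resolventPoints (mainOperator (controllableNode φ)) :=
  (isMaximalDissipative_mainOperator φ).mem_resolventPoints α.2

end Model

/-! ### The Cayley transform of the controllable model -/

section Cayley

theorem blockOperator_sub {X U Y : Type*} [NormedAddCommGroup X] [InnerProductSpace ℂ X]
    [NormedAddCommGroup U] [InnerProductSpace ℂ U] [NormedAddCommGroup Y] [InnerProductSpace ℂ Y]
    (A : X →L[ℂ] X) (B : U →L[ℂ] X) (C : X →L[ℂ] Y) (D : U →L[ℂ] Y) (p q : WithLp 2 (X × U)) :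
    blockOperator A B C D (p - q) = blockOperator A B C D p - blockOperator A B C D q := by
  refine WithLp.ofLp_injective 2 (Prod.ext ?_ ?_)
  · simp [blockOperator]
    abel
  · simp [blockOperator]
    abel

variable {U Y : Type*} [NormedAddCommGroup U] [InnerProductSpace ℂ U] [CompleteSpace U]
  [NormedAddCommGroup Y] [InnerProductSpace ℂ Y] [CompleteSpace Y]
  {φ : SchurHalfPlane U Y} {α : RightHalfPlane}
  (hα : (α : ℂ) ∈ resolventPoints (mainOperator (controllableNode φ)))

theorem resolventMap_mem_graph (x : HcHalfPlane φ) :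
    (((resolventMap (mainOperator (controllableNode φ)) hα x : HcHalfPlane φ), (0 : U)),
      ((α : ℂ) • (resolventMap (mainOperator (controllableNode φ)) hα x : HcHalfPlane φ) - x,
        tau φ hα x)) ∈ (controllableNode φ).graph := by
  have h := mainOperator_mem_graph (controllableNode φ)
    (resolventMap (mainOperator (controllableNode φ)) hα x)
  have h2 := smul_resolventMap_sub _ hα x
  rwa [← sub_eq_iff_eq_add.2 (sub_eq_iff_eq_add'.1 h2)] at h

theorem tau_eq {x z : HcHalfPlane φ} {y : Y}
    (h : ((x, (0 : U)), (z, y)) ∈ (controllableNode φ).graph) :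
    tau φ hα ((α : ℂ) • x - z) = y := by
  obtain ⟨q, rfl, rfl, rfl⟩ := exists_mainOperator_eq _ h
  change observation _ (resolventMap _ hα _) = _
  rw [resolventMap_apply_eq _ hα q rfl]

/-- The difference of the generators at `conj μ` and `α` has input zero and output
`φ (conj μ) u - φ α u`. -/
theorem tau_evalAdjoint (μ : RightHalfPlane) (u : U) :
    ((α : ℂ) - conj (μ : ℂ)) • tau φ hα (evalAdjoint φ μ u) = φ (conj (μ : ℂ)) u - φ α u := by
  have h := tau_eq hα (generator_sub_mem_graph φ μ.conj α u)
  rw [← RightHalfPlane.coe_conj, ← h, ← map_smul, RightHalfPlane.conj_conj, smul_sub, sub_smul]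
  congr 1
  abel

theorem norm_sqrt_smul_tau_le (x : HcHalfPlane φ) :
    ‖(√(2 * (α : ℂ).re) : ℂ) • tau φ hα x‖ ≤ ‖x‖ := by
  have hr := α.2
  have h := norm_sq_add_norm_sq_of_mem_graph (resolventMap_mem_graph hα x) α
  rw [sub_sub_cancel, norm_zero] at h
  refine le_of_sq_le_sq ?_ (norm_nonneg _)
  rw [norm_smul, Complex.norm_real, Real.norm_of_nonneg (Real.sqrt_nonneg _), mul_pow,
    Real.sq_sqrt (by positivity)]
  refine le_of_le_of_eq (le_add_of_nonneg_left (sq_nonneg _)) (h.symm.trans ?_)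
  ring

/-- The main operator `(conj α + A)(α - A)⁻¹ = 2 re α (α - A)⁻¹ - 1` of the Cayley transform. -/
def cayleyMain (φ : SchurHalfPlane U Y) (α : RightHalfPlane) : HcHalfPlane φ →L[ℂ] HcHalfPlane φ :=
  ((α : ℂ) + conj (α : ℂ)) • (isMaximalDissipative_mainOperator φ).resolvent α.2 - 1

theorem cayleyMain_apply (x : HcHalfPlane φ) : cayleyMain φ α x = ((α : ℂ) + conj (α : ℂ)) •
    (resolventMap (mainOperator (controllableNode φ)) hα x : HcHalfPlane φ) - x := rfl

/-- The observation operator `√(2 re α) C (α - A)⁻¹` of the Cayley transform. -/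
def cayleyObservation : HcHalfPlane φ →L[ℂ] Y :=
  ((√(2 * (α : ℂ).re) : ℂ) • tau φ hα).mkContinuous 1 fun x => by
    rw [one_mul]
    exact norm_sqrt_smul_tau_le hα x

theorem cayleyObservation_apply (x : HcHalfPlane φ) :
    cayleyObservation hα x = (√(2 * (α : ℂ).re) : ℂ) • tau φ hα x := rfl

theorem isCayleyTransform_controllableNode :
    IsCayleyTransform (controllableNode φ) α (cayleyMain φ α)
      ((√(2 * (α : ℂ).re) : ℂ) • evalAdjoint φ α.conj) (cayleyObservation hα) (φ α) where
  isSystemNode := isSystemNode_controllableNode φ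
  mem_res := hα
  main_eq x := by
    have h2 := smul_resolventMap_sub _ hα x
    rw [cayleyMain_apply hα, add_smul]
    nth_rewrite 3 [← h2]
    abel
  observation_eq x := rfl
  control_eq β hβ A' B h := by
    have hA := isMaximalDissipative_mainOperator φ
    have hA' := h.eq_extrapolationExtension hA
    have hbij : Function.Bijective (subExtension A' (α : ℂ)) := by
      rw [hA']
      exact hA.bijective_subExtension hβ hα
    have hE : ∀ u, (LinearEquiv.ofBijective _ hbij).symm (B u) = evalAdjoint φ α.conj u := by
      intro u
      rw [LinearEquiv.symm_apply_eq]
      exact (h.subExtension_apply (fun u => ⟨_, generator_mem_graph φ α u⟩) u).symm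
    refine ⟨hbij, fun u => ?_⟩
    rw [hE]
    refine ⟨rfl, LinearPMap.mem_domain_of_mem_graph (generator_mem_graph φ α u), ?_⟩
    have := LinearPMap.image_iff (LinearPMap.mem_domain_of_mem_graph (generator_mem_graph φ α u))
      |>.2 (generator_mem_graph φ α u)
    exact congrArg Prod.snd this

theorem isometry_cayleyTransform :
    Isometry (blockOperator (cayleyMain φ α) ((√(2 * (α : ℂ).re) : ℂ) • evalAdjoint φ α.conj)
      (cayleyObservation hα) (φ α)) := by
  have hr := α.2
  have hnorm : ∀ p : WithLp 2 (HcHalfPlane φ × U),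
      ‖blockOperator (cayleyMain φ α) ((√(2 * (α : ℂ).re) : ℂ) • evalAdjoint φ α.conj)
        (cayleyObservation hα) (φ α) p‖ = ‖p‖ := by
    intro p
    obtain ⟨w, u, rfl⟩ : ∃ w u, p = WithLp.toLp 2 (w, u) := ⟨p.fst, p.snd, rfl⟩
    set s : ℂ := (√(2 * (α : ℂ).re) : ℂ) with hs
    have hss : s * s = α + conj (α : ℂ) := sqrt_mul_sqrt α
    have hns : ‖s‖ ^ 2 = 2 * (α : ℂ).re := by
      rw [hs, Complex.norm_real, Real.norm_of_nonneg (Real.sqrt_nonneg _),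
        Real.sq_sqrt (by positivity)]
    -- the trajectory of the model with input `u` whose Cayley variable is `s w`
    have hg := (controllableNode φ).graph.add_mem
      ((controllableNode φ).graph.smul_mem s (resolventMap_mem_graph hα w))
      (generator_mem_graph φ α u)
    simp only [Prod.smul_mk, Prod.mk_add_mk, smul_zero, zero_add] at hg
    have h := norm_sq_add_norm_sq_of_mem_graph hg α
    have e1 : (α : ℂ) • (s • (resolventMap (mainOperator (controllableNode φ)) hα w :
          HcHalfPlane φ) + evalAdjoint φ α.conj u) -
        (s • ((α : ℂ) • (resolventMap (mainOperator (controllableNode φ)) hα w :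
          HcHalfPlane φ) - w) + (α : ℂ) • evalAdjoint φ α.conj u) = s • w := by
      module
    have e2 : conj (α : ℂ) • (s • (resolventMap (mainOperator (controllableNode φ)) hα w :
          HcHalfPlane φ) + evalAdjoint φ α.conj u) +
        (s • ((α : ℂ) • (resolventMap (mainOperator (controllableNode φ)) hα w :
          HcHalfPlane φ) - w) + (α : ℂ) • evalAdjoint φ α.conj u) =
        s • (cayleyMain φ α w + s • evalAdjoint φ α.conj u) := by
      rw [cayleyMain_apply hα, smul_add s, smul_smul s s, hss]
      module
    rw [e1, e2, norm_smul, norm_smul, mul_pow, mul_pow, hns] at h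
    rw [← sq_eq_sq₀ (norm_nonneg _) (norm_nonneg _), WithLp.prod_norm_sq_eq_of_L2,
      WithLp.prod_norm_sq_eq_of_L2]
    have h2 : (0 : ℝ) < 2 * (α : ℂ).re := by positivity
    refine mul_left_cancel₀ h2.ne' ?_
    rw [mul_add, mul_add]
    exact h.symm
  refine Isometry.of_dist_eq fun p q => ?_
  rw [dist_eq_norm, dist_eq_norm, ← hnorm (p - q)]
  rw [blockOperator_sub]

theorem cayleyMain_apply_apply (x : HcHalfPlane φ) (μ : RightHalfPlane) :
    cayleyMain φ α x μ = ((conj (α : ℂ) - μ) / (α + μ)) • x μ -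
      ((2 * (α : ℂ).re : ℂ) / (α + μ)) • (φ (conj (μ : ℂ))).adjoint (tau φ hα x) := by
  have h := apply_of_mem_graph (resolventMap_mem_graph hα x) μ
  have hne := α.add_ne_zero μ
  rw [RKHS.coe_sub, RKHS.coe_smul, Pi.sub_apply, Pi.smul_apply] at h
  rw [cayleyMain_apply hα, RKHS.coe_sub, RKHS.coe_smul, Pi.sub_apply, Pi.smul_apply]
  set r := (resolventMap (mainOperator (controllableNode φ)) hα x : HcHalfPlane φ) μ
  set t := (φ (conj (μ : ℂ))).adjoint (tau φ hα x)
  have hx : x μ = ((α : ℂ) + μ) • r + t := by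
    rw [zero_sub, sub_eq_iff_eq_add] at h
    rw [add_smul, h]
    abel
  have h2 : (2 * (α : ℂ).re : ℂ) = α + conj (α : ℂ) := by rw [Complex.add_conj]; push_cast; rfl
  rw [hx, h2]
  match_scalars <;> field_simp <;> ring

end Cayley

/-! ### The intertwinement with the model on the disk -/

section Disk

variable {U Y : Type*} [NormedAddCommGroup U] [InnerProductSpace ℂ U] [CompleteSpace U]
  [NormedAddCommGroup Y] [InnerProductSpace ℂ Y] [CompleteSpace Y]

/-- The defining identity of the observation operator away from zero, on kernel functions. At zero
the values follow by continuity. -/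
theorem adjoint_apply_eq_dslope {ψ : SchurDisk U Y} {C : HcDisk ψ →L[ℂ] Y}
    (hC : ∀ (z : Disk) (u : U),
      conj (z : ℂ) • C (RKHS.kerFun (HcDisk ψ) z u) = ψ (conj (z : ℂ)) u - ψ 0 u) (y : Y)
    (z : Disk) : C.adjoint y z = dslope (fun w : ℂ => (ψ (conj w)).adjoint y) 0 z := by
  set F : ℂ → U := fun w : ℂ => (ψ (conj w)).adjoint y with hF
  have hball : {z : ℂ | ‖z‖ < 1} = ball 0 1 := by ext; simp
  have hd : DifferentiableAt ℂ F 0 := by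
    have h1 : DifferentiableOn ℂ (fun z => (ψ (conj z)).adjoint) (ball 0 1) :=
      differentiableOn_adjoint_conj (t := ball 0 1) isOpen_ball (fun z hz => by simpa using hz)
        (hball ▸ ψ.differentiableOn)
    exact (h1.differentiableAt (ball_mem_nhds 0 one_pos)).clm_apply (differentiableAt_const y)
  have hne : ∀ z : Disk, (z : ℂ) ≠ 0 → C.adjoint y z = dslope F 0 z := by
    intro z hz
    have h1 : (z : ℂ) • C.adjoint y z = F z - F 0 := by
      refine ext_inner_right ℂ fun u => ?_
      rw [inner_smul_left, ← RKHS.inner_kerFun, ContinuousLinearMap.adjoint_inner_left,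
        ← inner_smul_right, hC, hF, inner_sub_left, inner_sub_right,
        ContinuousLinearMap.adjoint_inner_left, ContinuousLinearMap.adjoint_inner_left, map_zero]
    rw [dslope_of_ne _ hz, slope_def_module, sub_zero, ← h1, inv_smul_smul₀ hz]
  by_cases hz : (z : ℂ) = 0
  · have hlim : Tendsto (fun n : ℕ => ((1 / ((n : ℝ) + 2) : ℝ) : ℂ)) atTop (𝓝 0) := by
      have h := ((tendsto_one_div_add_atTop_nhds_zero_nat (𝕜 := ℝ)).comp
        (tendsto_add_atTop_nat 1)).ofReal
      rw [Complex.ofReal_zero] at h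
      refine h.congr fun n => ?_
      simp only [Function.comp, Nat.cast_add, Nat.cast_one]
      rw [add_assoc, one_add_one_eq_two]
    have hlt : ∀ n : ℕ, ‖((1 / ((n : ℝ) + 2) : ℝ) : ℂ)‖ < 1 := by
      intro n
      rw [Complex.norm_real, Real.norm_of_nonneg (by positivity), div_lt_one (by positivity)]
      have : (0 : ℝ) ≤ n := n.cast_nonneg
      linarith
    have hlim' : Tendsto (fun n : ℕ => (⟨_, hlt n⟩ : Disk)) atTop (𝓝 z) :=
      tendsto_subtype_rng.2 (by rwa [hz])
    refine ext_inner_right ℂ fun u => ?_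
    refine tendsto_nhds_unique
      (((continuous_inner_apply_disk ψ (C.adjoint y) u).tendsto z).comp hlim') ?_
    rw [hz]
    refine ((((continuousAt_dslope_same.2 hd).tendsto.comp hlim).inner
      (tendsto_const_nhds (x := u))).congr fun n => ?_)
    have h0 : ((1 / ((n : ℝ) + 2) : ℝ) : ℂ) ≠ 0 := by
      have : (1 / ((n : ℝ) + 2) : ℝ) ≠ 0 := by positivity
      exact_mod_cast this
    simp only [Function.comp]
    rw [hne ⟨_, hlt n⟩ h0]
  · exact hne z hz

/-- The transport of the Cayley transform along `Ξ` is the isometric model of `φ.toDisk α`. -/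
theorem exists_controllableDiskModel (φ : SchurHalfPlane U Y) (α : RightHalfPlane)
    (hα : (α : ℂ) ∈ resolventPoints (mainOperator (controllableNode φ))) :
    ∃ Ξ : HcDisk (φ.toDisk α) ≃ₗᵢ[ℂ] HcHalfPlane φ,
      (∀ (ξ : HcDisk (φ.toDisk α)) (μ : RightHalfPlane), Ξ ξ μ = xi α.conj ξ μ) ∧
      IsControllableDiskModel (φ.toDisk α)
        ((Ξ.symm.toContinuousLinearEquiv : HcHalfPlane φ →L[ℂ] HcDisk (φ.toDisk α)) ∘L
          cayleyMain φ α ∘L (Ξ.toContinuousLinearEquiv : HcDisk (φ.toDisk α) →L[ℂ] HcHalfPlane φ))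
        ((Ξ.symm.toContinuousLinearEquiv : HcHalfPlane φ →L[ℂ] HcDisk (φ.toDisk α)) ∘L
          ((√(2 * (α : ℂ).re) : ℂ) • evalAdjoint φ α.conj))
        (cayleyObservation hα ∘L
          (Ξ.toContinuousLinearEquiv : HcDisk (φ.toDisk α) →L[ℂ] HcHalfPlane φ))
        (φ α) := by
  obtain ⟨Ξ, hΞ, hker⟩ := exists_xi φ α
  have hψ : ∀ μ, (φ.toDisk α) (conj (cayleyToDisk α.conj μ : ℂ)) = φ (conj (μ : ℂ)) := fun μ =>
    congrArg φ (cayleyToHalfPlane_conj_cayleyToDisk α μ)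
  have hψ0 : (φ.toDisk α) 0 = φ α := congrArg φ (by simp [cayleyToHalfPlane])
  have hsymm : ∀ (x : HcHalfPlane φ) (μ : RightHalfPlane),
      x μ = weight α μ • Ξ.symm x (cayleyToDisk α.conj μ) := fun x μ => by
    rw [← hΞ, LinearIsometryEquiv.apply_symm_apply]
  refine ⟨Ξ, fun ξ μ => (hΞ ξ μ).trans (xi_conj_apply α ξ μ).symm, ?_, ?_, ?_, ?_⟩
  · intro g z
    obtain ⟨μ, rfl⟩ := cayleyToDisk_surjective α.conj z
    refine smul_right_injective U (weight_ne_zero α μ) ?_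
    change weight α μ • Ξ.symm (cayleyMain φ α (Ξ g)) (cayleyToDisk α.conj μ) = weight α μ •
      ((cayleyToDisk α.conj μ : ℂ) • g (cayleyToDisk α.conj μ) -
        ((φ.toDisk α) (conj (cayleyToDisk α.conj μ : ℂ))).adjoint (cayleyObservation hα (Ξ g)))
    rw [← hsymm, cayleyMain_apply_apply hα, hΞ, hψ, cayleyObservation_apply, map_smul, smul_sub,
      smul_smul, smul_smul, smul_smul, mul_comm (weight α μ) (cayleyToDisk α.conj μ : ℂ)]
    congr 2
    · simp only [cayleyToDisk, RightHalfPlane.coe_conj, Complex.conj_conj]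
    · rw [weight, div_mul_eq_mul_div, sqrt_mul_sqrt, Complex.add_conj]
      push_cast
      rfl
  · intro u z
    obtain ⟨μ, rfl⟩ := cayleyToDisk_surjective α.conj z
    refine smul_right_injective U (weight_ne_zero α μ) ?_
    change weight α μ • Ξ.symm ((√(2 * (α : ℂ).re) : ℂ) • evalAdjoint φ α.conj u)
      (cayleyToDisk α.conj μ) = weight α μ • _
    rw [← hsymm, hψ, hψ0, RKHS.coe_smul, Pi.smul_apply, evalAdjoint, RKHS.kerFun_apply,
      RKHS.OfKernel.kernel_ofKernel, kernelHalfPlane_apply, RightHalfPlane.coe_conj,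
      Complex.conj_conj, smul_smul, weight, div_eq_mul_inv, add_comm (μ : ℂ)]
  · intro y
    refine ⟨_, adjoint_apply_eq_dslope ?_ y, fun g =>
      (ContinuousLinearMap.adjoint_inner_right _ _ _).symm⟩
    intro z u
    obtain ⟨μ, rfl⟩ := cayleyToDisk_surjective α.conj z
    rw [hψ, hψ0, ← tau_evalAdjoint hα μ u, ← hker, map_smul, map_smul]
    change _ • cayleyObservation hα (Ξ _) = _
    have hne := α.conj.add_ne_zero μ.conj
    rw [RightHalfPlane.coe_conj, RightHalfPlane.coe_conj] at hne
    rw [cayleyObservation_apply, smul_smul, smul_smul]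
    congr 1
    simp only [weight, cayleyToDisk, RightHalfPlane.coe_conj, Complex.conj_conj, map_div₀, map_sub,
      map_add, Complex.conj_ofReal]
    field_simp
  · intro u
    rw [hψ0]

end Disk

end DeBrangesRovnyak

end

theorem proposition6p3 {U Y : Type*}
    [NormedAddCommGroup U] [InnerProductSpace ℂ U] [CompleteSpace U]
    [NormedAddCommGroup Y] [InnerProductSpace ℂ Y] [CompleteSpace Y]
    (φ : SchurHalfPlane U Y) (α : RightHalfPlane) :
    ∃ (hα : (α : ℂ) ∈ resolventPoints (mainOperator (controllableNode φ)))
      (bA : HcHalfPlane φ →L[ℂ] HcHalfPlane φ) (bB : U →L[ℂ] HcHalfPlane φ)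
      (bC : HcHalfPlane φ →L[ℂ] Y) (bD : U →L[ℂ] Y),
      -- the Cayley transform of the controllable model, which is isometric, and its formulas
      IsCayleyTransform (controllableNode φ) α bA bB bC bD ∧
      Isometry (blockOperator bA bB bC bD) ∧
      (∀ (x : HcHalfPlane φ) (μ : RightHalfPlane),
        bA x μ = ((conj (α : ℂ) - μ) / (α + μ)) • x μ -
          ((2 * (α : ℂ).re : ℂ) / (α + μ)) • (φ (conj (μ : ℂ))).adjoint (tau φ hα x)) ∧
      (∀ u : U, bB u = (√(2 * (α : ℂ).re) : ℂ) • evalAdjoint φ α.conj u) ∧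
      (∀ x : HcHalfPlane φ, bC x = (√(2 * (α : ℂ).re) : ℂ) • tau φ hα x) ∧
      (∀ u : U, bD u = φ α u) ∧
      -- the unitary operator between the disk space and the half-plane space
      ∃ Ξ : HcDisk (φ.toDisk α) ≃ₗᵢ[ℂ] HcHalfPlane φ,
        (∀ (ξ : HcDisk (φ.toDisk α)) (μ : RightHalfPlane), Ξ ξ μ = xi α.conj ξ μ) ∧
        -- the intertwinement with the disk model
        ∃ (A : HcDisk (φ.toDisk α) →L[ℂ] HcDisk (φ.toDisk α)) (B : U →L[ℂ] HcDisk (φ.toDisk α))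
          (C : HcDisk (φ.toDisk α) →L[ℂ] Y) (D : U →L[ℂ] Y),
          IsControllableDiskModel (φ.toDisk α) A B C D ∧
          (∀ ξ : HcDisk (φ.toDisk α), bA (Ξ ξ) = Ξ (A ξ)) ∧
          (∀ u : U, bB u = Ξ (B u)) ∧
          (∀ ξ : HcDisk (φ.toDisk α), bC (Ξ ξ) = C ξ) ∧
          (∀ u : U, bD u = D u) := by
  have hα := mem_resolventPoints_controllableNode φ α
  obtain ⟨Ξ, hΞ, hmodel⟩ := exists_controllableDiskModel φ α hα
  refine ⟨hα, _, _, _, _, isCayleyTransform_controllableNode hα, isometry_cayleyTransform hα,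
    cayleyMain_apply_apply hα, fun _ => rfl, fun _ => rfl, fun _ => rfl, Ξ, hΞ, _, _, _, _, hmodel,
    fun ξ => ?_, fun u => ?_, fun _ => rfl, fun _ => rfl⟩
  · exact (Ξ.apply_symm_apply _).symm
  · exact (Ξ.apply_symm_apply _).symm
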